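/- **Setting.** A finite quantum system consists of finitely many degrees of freedom located on the sites of a metric space (several may share a site): qudits $j$ of prime dimension $D_j$, and $N_f$ fermionic degrees of freedom $j$, each with Hermitian Majorana operators $\gamma_j,\gamma'_j$ satisfying $\{\gamma_i,\gamma_j\}=\{\gamma'_i,\gamma'_j\}=2\delta_{ij}$, $\{\gamma_i,\gamma'_j\}=0$, and assigned $D_j=2$. The Hilbert space has dimension $2^{N_f}\prod_{j\ \text{qudit}}D_j$. An operator is supported on a set $S$ of sites if it lies in the algebra generated by the Majorana operators and the single-qudit operators of the degrees of freedom on sites in $S$. An operator is even (odd) if it commutes (anticommutes) with $\prod_j\gamma_j\gamma'_j$. A QCA of range $r$ is a $*$-automorphism $\alpha$ of the algebra of all operators which maps even operators to even ones and odd operators to odd ones, and maps every operator supported on a site $i$ to an operator supported on the sites within distance $r$ of $i$. For a qudit $j$, $Z_j=\sum_{k=0}^{D_j-1}e^{2\pi i k/D_j}|k\rangle\langle k|$. A separator of diameter $R$ is a family of unitaries ${\cal Z}_a$ with integers $D_a\ge 2$ such that: every ${\cal Z}_a$ is even; ${\cal Z}_a^{D_a}=I$; all ${\cal Z}_a$ commute;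 every ${\cal Z}_a$ is supported on a set of sites of diameter at most $R$; and for any choice of $D_a$-th roots of unity $\omega(a)$ the space $\{\psi:{\cal Z}_a\psi=\omega(a)\psi\ \forall a\}$ is one-dimensional. Each element with $D_a=2$ is designated either a qudit element or a fermionic element; elements with $D_a>2$ are qudit elements. A local flipper of radius $R$ for it is a family of unitaries $\tilde{\cal X}_a$, each supported on a closed ball of radius $R$, such that $\tilde{\cal X}_a$ commutes with ${\cal Z}_b$ for $b\ne a$, ${\cal Z}_a\tilde{\cal X}_a=e^{2\pi i/D_a}\tilde{\cal X}_a{\cal Z}_a$, and $\tilde{\cal X}_a$ is even if $a$ is a qudit element and odd if $a$ is fermionic. A separator with a local flipper is called locally flippable. A separator $\{{\cal W}_a\}$ is trivial, via a bijection $f$ from elements to degrees of freedom, if for every qudit element $f(a)$ is a qudit and ${\cal W}_a=Z_{f(a)}$, and for every fermionic element $f(a)$ is fermionic and ${\cal W}_a=i\gamma'_{f(a)}\gamma_{f(a)}$. **Theorem.** (1) There is a universal constant $C$ such that the following holds. In any finite system without fermionic degrees of freedom, for any locally flippable separator $\{{\cal Z}_a\}$ (separator of diameter $R$, flipper of radius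 $R$) with all $D_a$ prime, there are a QCA $\alpha$ of range $CR$ and a bijection $f$ from elements to qudits such that the image $\{\alpha({\cal Z}_a)\}$ is a trivial separator via $f$; that is, $\alpha({\cal Z}_a)=Z_{f(a)}$ for all $a$. (2) For every $K$ there is a constant $C$, depending only on $K$, such that the following holds. In any finite system, possibly with fermionic degrees of freedom, let $\{{\cal Z}_a\}$ be a separator of diameter $R$ with all $D_a$ prime and with a local flipper $\{\tilde{\cal X}_a\}$ of radius $R$. Assume that there is a bijection $g$ from the elements $a$ with $D_a=2$ to the degrees of freedom $j$ with $D_j=2$ (qubits and fermionic degrees of freedom) such that $g(a)$ is a qudit if $\tilde{\cal X}_a$ is even, $g(a)$ is fermionic if $\tilde{\cal X}_a$ is odd, and the site of $g(a)$ is within distance $KR$ of some site of a set of diameter at most $R$ supporting ${\cal Z}_a$. Then there are a QCA $\alpha$ of range $CR$ and a bijection $f$ from elements to degrees of freedom, with $f(a)=g(a)$ whenever $D_a=2$, such that $\{\alpha({\cal Z}_a)\}$ is a trivial separator via $f$; that is, $\alpha({\cal Z}_a)=Z_{f(a)}$ if $a$ is a qudit element and $\alpha({\cal Z}_a)=i\gamma'_{f(a)}\gamma_{f(a)}$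 if $a$ is fermionic. -/

import Mathlib

/-- A finite collection of degrees of freedom located on the sites of `Site`: qudits of prime
dimension and fermionic degrees of freedom. Several of them may sit on the same site. -/
structure QuantumSystem (Site : Type*) where
  numQudits : ℕ
  quditDim : Fin numQudits → ℕ
  quditDim_prime : ∀ q, (quditDim q).Prime
  quditSite : Fin numQudits → Site
  numFermions : ℕ
  fermionSite : Fin numFermions → Site

namespace QuantumSystem

variable {Site : Type*} (S : QuantumSystem Site)

/-- Labels of the standard basis: a computational basis state of every qudit and an occupation
number of every fermionic mode. The Hilbert space of the system is `S.Basis → ℂ`, of dimension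
`(∏ q, quditDim q) * 2 ^ numFermions`. -/
abbrev Basis : Type :=
  ((q : Fin S.numQudits) → Fin (S.quditDim q)) × (Fin S.numFermions → Bool)

/-- Operators on the Hilbert space. -/
abbrev Op : Type := Matrix S.Basis S.Basis ℂ

/-- The degrees of freedom: qudits (`Sum.inl`) and fermionic ones (`Sum.inr`). -/
abbrev Dof : Type := Fin S.numQudits ⊕ Fin S.numFermions

/-- The site of a degree of freedom. -/
def dofSite : S.Dof → Site := Sum.elim S.quditSite S.fermionSite

/-- The dimension of a degree of freedom; it is `2` for a fermionic one. -/
def dofDim : S.Dof → ℕ := Sum.elim S.quditDim fun _ => 2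

/-- The operator `A` acting on the qudit `q`, and trivially on everything else. -/
def quditOp (q : Fin S.numQudits) (A : Matrix (Fin (S.quditDim q)) (Fin (S.quditDim q)) ℂ) :
    S.Op :=
  Matrix.of fun x y =>
    if x.2 = y.2 ∧ ∀ r, r ≠ q → x.1 r = y.1 r then A (x.1 q) (y.1 q) else 0

/-- The generalized Pauli operator `Z = ∑ₖ exp (2πik/D) |k⟩⟨k|` on the qudit `q`. -/
noncomputable def pauliZ (q : Fin S.numQudits) : S.Op :=
  S.quditOp q (Matrix.diagonal fun k =>
    Complex.exp (2 * Real.pi * Complex.I * ((k : ℕ) : ℂ) / (S.quditDim q : ℂ)))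

/-- The sign `(-1) ^ ∑_{k < j} n k`. -/
def stringSign (j : Fin S.numFermions) (n : Fin S.numFermions → Bool) : ℂ :=
  ∏ k ∈ Finset.univ.filter (· < j), if n k then -1 else 1

/-- The Majorana operator `γ_j`: it flips the occupation number of the mode `j`, with the sign
`(-1) ^ ∑_{k < j} n k`. -/
def majorana (j : Fin S.numFermions) : S.Op :=
  Matrix.of fun x y =>
    if x.1 = y.1 ∧ x.2 = Function.update y.2 j (!y.2 j) then S.stringSign j y.2 else 0

/-- The Majorana operator `γ'_j`: like `γ_j`, with the additional phase `i` on empty and `-i` on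
occupied states of the mode `j`. -/
def majorana' (j : Fin S.numFermions) : S.Op :=
  Matrix.of fun x y =>
    if x.1 = y.1 ∧ x.2 = Function.update y.2 j (!y.2 j) then
      S.stringSign j y.2 * (if y.2 j then -Complex.I else Complex.I) else 0

/-- The product of `γ_j γ'_j` over all fermionic degrees of freedom. -/
def parityOp : S.Op := (List.ofFn fun j => S.majorana j * S.majorana' j).prod

/-- Even fermion parity. -/
def IsEven (O : S.Op) : Prop := S.parityOp * O = O * S.parityOp

/-- Odd fermion parity. -/
def IsOdd (O : S.Op) : Prop := S.parityOp * O = -(O * S.parityOp)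

/-- The algebra of operators supported on a set `Ω` of sites. -/
def localAlgebra (Ω : Set Site) : Subalgebra ℂ S.Op :=
  Algebra.adjoin ℂ
    ({O | ∃ j, S.fermionSite j ∈ Ω ∧ (O = S.majorana j ∨ O = S.majorana' j)} ∪
      {O | ∃ q A, S.quditSite q ∈ Ω ∧ O = S.quditOp q A})

/-- `O` is supported on the set `Ω` of sites. -/
def SupportedOn (Ω : Set Site) (O : S.Op) : Prop := O ∈ S.localAlgebra Ω

variable [MetricSpace Site]

/-- `Ω` is a set of sites of diameter at most `R` on which `O` is supported. -/
def IsSupportingDisk (R : ℝ) (O : S.Op) (Ω : Set Site) : Prop :=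
  (∀ s ∈ Ω, ∀ t ∈ Ω, dist s t ≤ R) ∧ S.SupportedOn Ω O

/-- The `*`-automorphism `α` of the algebra of all operators is a quantum cellular automaton of
range `R`: it preserves even and odd fermion parity of operators, and it maps operators supported
on a site to operators supported on the sites within distance `R`. -/
structure IsQCA (R : ℝ) (α : S.Op ≃⋆ₐ[ℂ] S.Op) : Prop where
  even : ∀ O, S.IsEven O → S.IsEven (α O)
  odd : ∀ O, S.IsOdd O → S.IsOdd (α O)
  range : ∀ (i : Site) (O : S.Op), S.SupportedOn {i} O →
    S.SupportedOn (Metric.closedBall i R) (α O)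

variable {ι : Type*}

/-- The operators `Z a`, with orders `D a`, form a separator of diameter `R`. The predicate
`fermionic` singles out the fermionic elements; all others are qudit elements. -/
structure IsSeparator (R : ℝ) (D : ι → ℕ) (fermionic : ι → Prop) (Z : ι → S.Op) : Prop where
  unitary : ∀ a, Z a ∈ unitary S.Op
  even : ∀ a, S.IsEven (Z a)
  two_le : ∀ a, 2 ≤ D a
  pow_eq_one : ∀ a, Z a ^ D a = 1
  commute : ∀ a b, Z a * Z b = Z b * Z a
  local_support : ∀ a, ∃ Ω, S.IsSupportingDisk R (Z a) Ω
  one_dimensional : ∀ ω : ι → ℂ, (∀ a, ω a ^ D a = 1) →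
    Module.finrank ℂ
      (⨅ a, Module.End.eigenspace (Matrix.toLin' (Z a)) (ω a) : Submodule ℂ (S.Basis → ℂ)) = 1
  fermionic_dim : ∀ a, fermionic a → D a = 2

/-- The operators `X a` form a local flipper, of radius `R`, for the separator `Z`. -/
structure IsLocalFlipper (R : ℝ) (D : ι → ℕ) (fermionic : ι → Prop) (Z X : ι → S.Op) :
    Prop where
  unitary : ∀ a, X a ∈ unitary S.Op
  local_support : ∀ a, ∃ c : Site, S.SupportedOn (Metric.closedBall c R) (X a)
  commute : ∀ a b, b ≠ a → Z b * X a = X a * Z b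
  flip : ∀ a, Z a * X a = Complex.exp (2 * Real.pi * Complex.I / (D a : ℂ)) • (X a * Z a)
  even : ∀ a, ¬ fermionic a → S.IsEven (X a)
  odd : ∀ a, fermionic a → S.IsOdd (X a)

/-- The separator `Z` is locally flippable. -/
def LocallyFlippable (R : ℝ) (D : ι → ℕ) (fermionic : ι → Prop) (Z : ι → S.Op) : Prop :=
  ∃ X : ι → S.Op, S.IsLocalFlipper R D fermionic Z X

/-- The operators `W a` form a trivial separator, as witnessed by the bijection `f` from elements
to degrees of freedom: qudit elements are `Z_{f a}`, fermionic ones are `i γ'_{f a} γ_{f a}`. -/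
structure IsTrivialSeparator (D : ι → ℕ) (fermionic : ι → Prop) (W : ι → S.Op)
    (f : ι ≃ S.Dof) : Prop where
  separator : S.IsSeparator 0 D fermionic W
  qudit : ∀ a, ¬ fermionic a → ∃ q, f a = Sum.inl q ∧ W a = S.pauliZ q
  fermion : ∀ a, fermionic a →
    ∃ j, f a = Sum.inr j ∧ W a = Complex.I • (S.majorana' j * S.majorana j)

end QuantumSystem

/-! ### Basis labels, cyclic shifts, and phases in axial gauge. -/

namespace QuantumSystem

variable {Site : Type*} (S : QuantumSystem Site)

/-! Suppose first that the elements are labelled by the degrees of freedom, with matching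
dimensions, parities and locations. Starting from the joint eigenvector with all eigenvalues one,
the flippers generate an orthonormal joint eigenbasis indexed by the computational basis states. The
unitary with these columns conjugates each element to the standard clock operator, and each flipper
to a cyclic shift with phases `t a y`. This conjugation is the required automorphism; only its
locality is in question, because nearby flippers need not commute and `t a y` could depend on all
labels.

The basis is generated by applying the flippers in a fixed order. This puts the phases in axial
gauge: `t a y = 1` when all labels below `a` vanish and the label of `a` does not wrap around. The
Jordan–Wigner signs of the standard flippers satisfy the same condition. Distant flippers commute or
anticommute according to parity, just as the standard ones do, so the ratio of the two phases is
flat (has trivial plaquettes) on distant pairs. Axial gauge and flatness together force the ratio at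
`a` to be independent of every label whose flipper is centered more than `4 * R` away
(`phase_shift_invariant`).

An operator at a site commutes with the distant elements and with the distant flippers, the odd ones
being multiplied by the parity operator. Its image therefore preserves distant labels, the phase
ratios cancel, and the image commutes with the distant standard clocks and twisted flippers. A
commutant computation (`mem_dofAlgebra_of_commute`) places it in the algebra of the nearby degrees
of freedom. This is `exists_automorphism`.

The labelling comes from Hall's theorem, one prime `p` at a time. The trace of the projection on the
eigenvalue-one space of a set `A` of elements of dimension `p` is computed in the joint eigenbasis,
and is also a multiple of the dimension of the qudits away from `A`. Hence `p ^ A.card` divides `2 ^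
numFermions` times the dimension of the nearby qudits (`IsSeparator.pow_card_dvd`), which is Hall's
condition if `p` is odd or there are no fermions. In the remaining case the matching is the given
`g`. The combined injection is onto because both products of dimensions equal the dimension of the
Hilbert space. -/

instance quditDim_neZero (q : Fin S.numQudits) : NeZero (S.quditDim q) :=
  ⟨(S.quditDim_prime q).ne_zero⟩

theorem two_le_dofDim (a : S.Dof) : 2 ≤ S.dofDim a := by
  rcases a with q | j
  · exact (S.quditDim_prime q).two_le
  · exact le_refl 2

/-- Increases the label of one degree of freedom by one, cyclically. -/
def shift : S.Dof → S.Basis → S.Basis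
  | Sum.inl q, y => (Function.update y.1 q (y.1 q + 1), y.2)
  | Sum.inr j, y => (y.1, Function.update y.2 j (!y.2 j))

/-- The label of one degree of freedom in a basis state. -/
def digit : S.Dof → S.Basis → ℕ
  | Sum.inl q, y => (y.1 q : ℕ)
  | Sum.inr j, y => (y.2 j).toNat

/-- The basis state with all labels zero. -/
def vacuum : S.Basis := (fun _ => 0, fun _ => false)

/-- A position of the degree of freedom in a linear order: qudits first, then fermions. -/
def rank : S.Dof → ℕ
  | Sum.inl q => q
  | Sum.inr j => S.numQudits + j

variable {S}

theorem rank_injective : Function.Injective S.rank := by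
  rintro (q | j) (q' | j') h <;> simp only [rank] at h
  · exact congrArg _ (Fin.ext h)
  · have := q.2; omega
  · have := q'.2; omega
  · exact congrArg _ (Fin.ext (by omega))

theorem digit_lt (a : S.Dof) (y : S.Basis) : S.digit a y < S.dofDim a := by
  rcases a with q | j
  · exact (y.1 q).2
  · exact Bool.toNat_lt _

@[simp] theorem digit_vacuum (a : S.Dof) : S.digit a S.vacuum = 0 := by
  rcases a with q | j <;> simp [digit, vacuum]

theorem basis_ext {x y : S.Basis} (h : ∀ a, S.digit a x = S.digit a y) : x = y := by
  refine Prod.ext (funext fun q => Fin.ext (h (Sum.inl q))) (funext fun j => ?_)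
  have := h (Sum.inr j)
  simp only [digit] at this
  cases hx : x.2 j <;> cases hy : y.2 j <;> simp_all

theorem digit_shift_self (a : S.Dof) (y : S.Basis) :
    S.digit a (S.shift a y) = (S.digit a y + 1) % S.dofDim a := by
  rcases a with q | j
  · simp only [digit, shift, dofDim, Function.update_self, Sum.elim_inl, Fin.val_add]
    rw [Fin.val_one', Nat.add_mod_mod]
  · simp only [digit, shift, dofDim, Function.update_self, Sum.elim_inr]
    cases y.2 j <;> rfl

theorem digit_shift_of_ne {a b : S.Dof} (h : b ≠ a) (y : S.Basis) :
    S.digit b (S.shift a y) = S.digit b y := by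
  rcases a with q | j <;> rcases b with q' | j' <;> simp only [digit, shift]
  · rw [Function.update_of_ne (fun e => h (by rw [e]))]
  · rw [Function.update_of_ne (fun e => h (by rw [e]))]

theorem digit_shift_of_lt {a : S.Dof} {y : S.Basis} (h : S.digit a y + 1 < S.dofDim a) :
    S.digit a (S.shift a y) = S.digit a y + 1 := by
  rw [digit_shift_self, Nat.mod_eq_of_lt h]

theorem shift_comm (a b : S.Dof) (y : S.Basis) :
    S.shift a (S.shift b y) = S.shift b (S.shift a y) := by
  by_cases hab : a = b
  · rw [hab]
  refine basis_ext fun c => ?_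
  by_cases hca : c = a
  · subst hca
    rw [digit_shift_self, digit_shift_of_ne hab, digit_shift_of_ne hab, digit_shift_self]
  · by_cases hcb : c = b
    · subst hcb
      rw [digit_shift_of_ne hca, digit_shift_self, digit_shift_self, digit_shift_of_ne hca]
    · rw [digit_shift_of_ne hca, digit_shift_of_ne hcb, digit_shift_of_ne hcb,
        digit_shift_of_ne hca]

theorem digit_shift_iterate_self (a : S.Dof) (y : S.Basis) (k : ℕ) :
    S.digit a ((S.shift a)^[k] y) = (S.digit a y + k) % S.dofDim a := by
  induction k with
  | zero => simp [Nat.mod_eq_of_lt (digit_lt a y)]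
  | succ k ih => rw [Function.iterate_succ_apply', digit_shift_self, ih, Nat.mod_add_mod, add_assoc]

theorem digit_shift_iterate_of_ne {a b : S.Dof} (h : b ≠ a) (y : S.Basis) (k : ℕ) :
    S.digit b ((S.shift a)^[k] y) = S.digit b y := by
  induction k with
  | zero => rfl
  | succ k ih => rw [Function.iterate_succ_apply', digit_shift_of_ne h, ih]

theorem shift_iterate_dofDim (a : S.Dof) (y : S.Basis) :
    (S.shift a)^[S.dofDim a] y = y := by
  refine basis_ext fun b => ?_
  by_cases h : b = a
  · subst h
    rw [digit_shift_iterate_self, Nat.add_mod_right, Nat.mod_eq_of_lt (digit_lt _ y)]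
  · rw [digit_shift_iterate_of_ne h]

theorem shift_iterate_pred (a : S.Dof) (y : S.Basis) :
    S.shift a ((S.shift a)^[S.dofDim a - 1] y) = y := by
  rw [← Function.iterate_succ_apply' (S.shift a)]
  have : (S.dofDim a - 1).succ = S.dofDim a := by have := S.two_le_dofDim a; omega
  rw [this, shift_iterate_dofDim]

theorem shift_bijective (a : S.Dof) : Function.Bijective (S.shift a) :=
  Finite.surjective_iff_bijective.1 fun y => ⟨_, shift_iterate_pred a y⟩

theorem exists_shift_eq {a : S.Dof} {y : S.Basis} (h : S.digit a y ≠ 0) :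
    ∃ x, S.shift a x = y ∧ S.digit a y = S.digit a x + 1 ∧ S.digit a x + 1 < S.dofDim a := by
  obtain ⟨x, rfl⟩ := (shift_bijective a).2 y
  refine ⟨x, rfl, ?_⟩
  rw [digit_shift_self] at h ⊢
  have hx := digit_lt a x
  have : S.digit a x + 1 < S.dofDim a := by
    by_contra hc
    exact h (by rw [show S.digit a x + 1 = S.dofDim a by omega, Nat.mod_self])
  exact ⟨Nat.mod_eq_of_lt this, this⟩

theorem sum_digit_lt {a : S.Dof} {x y : S.Basis} (hx : S.shift a x = y)
    (h : S.digit a y = S.digit a x + 1) : ∑ b, S.digit b x < ∑ b, S.digit b y := by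
  refine Finset.sum_lt_sum (fun b _ => ?_) ⟨a, Finset.mem_univ a, by omega⟩
  by_cases hb : b = a
  · subst hb; omega
  · rw [← hx, digit_shift_of_ne hb]

/-- A function invariant under the shifts in `N` depends only on the digits outside `N`. -/
theorem eq_of_shift_invariant {β : Type*} {N : Set S.Dof} {F : S.Basis → β}
    (hF : ∀ a ∈ N, ∀ y, F (S.shift a y) = F y) :
    ∀ x y : S.Basis, (∀ a ∉ N, S.digit a x = S.digit a y) → F x = F y := by
  have key : ∀ n : ℕ, ∀ x y : S.Basis, ∑ b, S.digit b x + ∑ b, S.digit b y = n →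
      (∀ a ∉ N, S.digit a x = S.digit a y) → F x = F y := by
    intro n
    induction n using Nat.strong_induction_on with
    | _ n ih =>
      intro x y hn hxy
      -- Lower a nonzero label in `N`, first in `x` and then in `y`. The total label sum drops each
      -- time, and the states coincide once neither has a nonzero label in `N`.
      by_cases hx : ∃ a ∈ N, S.digit a x ≠ 0
      · obtain ⟨a, ha, hax⟩ := hx
        obtain ⟨x', hx', hd, -⟩ := exists_shift_eq hax
        have := sum_digit_lt hx' hd
        rw [← ih _ (by omega) x' y rfl, ← hx', hF a ha]
        intro b hb
        rw [← hxy b hb, ← hx', digit_shift_of_ne (by rintro rfl; exact hb ha)]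
      by_cases hy : ∃ a ∈ N, S.digit a y ≠ 0
      · obtain ⟨a, ha, hay⟩ := hy
        obtain ⟨y', hy', hd, -⟩ := exists_shift_eq hay
        have := sum_digit_lt hy' hd
        rw [ih _ (by omega) x y' rfl, ← hy', hF a ha]
        intro b hb
        rw [hxy b hb, ← hy', digit_shift_of_ne (by rintro rfl; exact hb ha)]
      push Not at hx hy
      congr 1
      refine basis_ext fun a => ?_
      by_cases ha : a ∈ N
      · rw [hx a ha, hy a ha]
      · exact hxy a ha
  exact fun x y h => key _ x y rfl h

/-- Flux-free phases in axial gauge: the phases `u a` do not depend on the label of `c`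
when no degree of freedom is close to both `a` and `c`. -/
theorem phase_shift_invariant {u : S.Dof → S.Basis → ℂ} {far : S.Dof → S.Dof → Prop}
    (hu : ∀ a y, u a y ≠ 0) (far_symm : ∀ a b, far a b → far b a)
    (gauge : ∀ a y, (∀ b, S.rank b < S.rank a → S.digit b y = 0) →
      S.digit a y + 1 < S.dofDim a → u a y = 1)
    (flat : ∀ a b, far a b → ∀ y, u a (S.shift b y) * u b y = u b (S.shift a y) * u a y)
    {a c : S.Dof} (hac : far a c) (hne : a ≠ c) (hfar : ∀ b, far b a ∨ far b c) (y : S.Basis) :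
    u a (S.shift c y) = u a y := by
  -- Flatness of the pair makes invariance of `u a` under `c` equivalent to invariance of `u c`
  -- under `a`, so the order of the two ranks is immaterial.
  wlog hlt : S.rank a < S.rank c generalizing a c
  · have hlt' : S.rank c < S.rank a :=
      lt_of_le_of_ne (not_lt.1 hlt) fun e => hne (rank_injective e.symm)
    have h := this (far_symm _ _ hac) hne.symm (fun b => (hfar b).symm) hlt'
    have hf := flat a c hac y
    rw [h, mul_comm (u c y)] at hf
    exact mul_right_cancel₀ (hu c y) hf
  have key : ∀ n : ℕ, ∀ y : S.Basis, ∑ b, S.digit b y = n → u a (S.shift c y) = u a y := by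
    intro n
    induction n using Nat.strong_induction_on with
    | _ n ih =>
    intro y hn
    have swap : ∀ y, u a (S.shift c y) = u a y ↔ u c (S.shift a y) = u c y := by
      intro y
      have hf := flat a c hac y
      constructor <;> intro h
      · rw [h, mul_comm (u a y)] at hf
        exact (mul_right_cancel₀ (hu a y) hf).symm
      · rw [h, mul_comm (u c y)] at hf
        exact mul_right_cancel₀ (hu c y) hf
    -- Peel off the lowest nonzero label `b` below `a`. By the gauge condition `u b = 1` at `y'` and
    -- at its shifts by `a`, by `c` and by both. Flatness of `b` with whichever of `a`, `c` is far
    -- from it then carries the claim from `y'` to `y`.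
    by_cases hb : ∃ b, S.rank b < S.rank a ∧ S.digit b y ≠ 0
    · obtain ⟨b, ⟨hba, hby⟩, hmin⟩ :=
        (Set.toFinite {b | S.rank b < S.rank a ∧ S.digit b y ≠ 0}).exists_minimalFor S.rank _ hb
      have hmin' : ∀ e, S.rank e < S.rank b → S.digit e y = 0 := by
        intro e he
        by_contra hne
        exact absurd (hmin ⟨he.trans hba, hne⟩ he.le) (not_le.2 he)
      obtain ⟨y', hy', hd, hd'⟩ := exists_shift_eq hby
      have hsum := sum_digit_lt hy' hd
      have hIH := ih _ (by omega) y' rfl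
      have hab : b ≠ a := fun e => by rw [e] at hba; exact lt_irrefl _ hba
      have hbc : b ≠ c := fun e => by rw [e] at hba; exact absurd hba (not_lt.2 hlt.le)
      have hz : ∀ e, S.rank e < S.rank b → S.digit e y' = 0 := by
        intro e he
        have : e ≠ b := fun h => by rw [h] at he; exact lt_irrefl _ he
        rw [← hmin' e he, ← hy', digit_shift_of_ne this]
      have g0 : u b y' = 1 := gauge b y' hz hd'
      have gs : ∀ d, S.rank b < S.rank d → u b (S.shift d y') = 1 := by
        intro d hd
        refine gauge b _ (fun e he => ?_) ?_
        · rw [digit_shift_of_ne (fun h => ?_), hz e he]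
          rw [h] at he; omega
        · rwa [digit_shift_of_ne (fun h => ?_)]
          rw [h] at hd; omega
      have gss : u b (S.shift a (S.shift c y')) = 1 := by
        refine gauge b _ (fun e he => ?_) ?_
        · rw [digit_shift_of_ne (fun h => ?_), digit_shift_of_ne (fun h => ?_), hz e he] <;>
            rw [h] at he <;> omega
        · rwa [digit_shift_of_ne hab, digit_shift_of_ne hbc]
      rcases hfar b with hf | hf
      · have e1 := flat b a hf y'
        have e2 := flat b a hf (S.shift c y')
        rw [gs a hba, one_mul, g0, mul_one] at e1
        rw [gss, one_mul, gs c (hba.trans hlt), mul_one] at e2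
        rw [← hy', shift_comm c b, ← e2, ← e1, hIH]
      · rw [swap]
        have e1 := flat b c hf y'
        have e2 := flat b c hf (S.shift a y')
        rw [gs c (hba.trans hlt), one_mul, g0, mul_one] at e1
        rw [shift_comm c a, gss, one_mul, gs a hba, mul_one] at e2
        rw [← hy', shift_comm a b, ← e2, ← e1, (swap y').1 hIH]
    · push Not at hb
      have base : ∀ y : S.Basis, (∀ b, S.rank b < S.rank a → S.digit b y = 0) →
          S.digit a y + 1 < S.dofDim a → u a (S.shift c y) = u a y := by
        intro y hb h
        rw [gauge a y hb h]
        refine gauge a _ (fun b hba => ?_) ?_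
        · rw [digit_shift_of_ne (fun e => ?_), hb b hba]
          rw [e] at hba; omega
        · rwa [digit_shift_of_ne hne]
      by_cases h : S.digit a y + 1 < S.dofDim a
      · exact base y hb h
      -- The label of `a` is maximal here, and the gauge condition is silent about the wrapping
      -- step. For `u c` the other `dofDim a - 1` steps of the cycle are controlled by `base` and
      -- `swap`, and they lead from `shift a y` back to `y`.
      · rw [swap]
        have hD := S.two_le_dofDim a
        have hlast : S.digit a y = S.dofDim a - 1 := by have := digit_lt a y; omega
        have hstep : ∀ k, k ≤ S.dofDim a - 1 →
            u c ((S.shift a)^[k] (S.shift a y)) = u c (S.shift a y) := by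
          intro k
          induction k with
          | zero => intro; rfl
          | succ k ihk =>
            intro hk
            rw [Function.iterate_succ_apply', ← ihk (by omega)]
            refine (swap _).1 (base _ (fun b hba => ?_) ?_)
            · have hb' : b ≠ a := fun e => by rw [e] at hba; exact lt_irrefl _ hba
              rw [digit_shift_iterate_of_ne hb', digit_shift_of_ne hb', hb b hba]
            · rw [digit_shift_iterate_self, digit_shift_self, hlast,
                show S.dofDim a - 1 + 1 = S.dofDim a by omega, Nat.mod_self, zero_add,
                Nat.mod_eq_of_lt (by omega)]
              omega
        have hfin := hstep _ le_rfl
        rw [← Function.iterate_succ_apply, Function.iterate_succ_apply', shift_iterate_pred]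
          at hfin
        exact hfin.symm
  exact key _ y rfl

end QuantumSystem

/-! ### Monomial operators, standard clocks and flippers, Jordan–Wigner signs. -/

namespace QuantumSystem

variable {Site : Type*} (S : QuantumSystem Site)

/-- The operator mapping the basis state `y` to `s y` times the basis state `σ y`. -/
def monomial (σ : S.Basis → S.Basis) (s : S.Basis → ℂ) : S.Op :=
  Matrix.of fun x y => if x = σ y then s y else 0

/-- The phase of the standard flipper: `1` for a qudit, the string sign for a fermion. -/
def phase : S.Dof → S.Basis → ℂ
  | Sum.inl _, _ => 1
  | Sum.inr j, y => S.stringSign j y.2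

/-- The phase of the operator `γ'`. -/
def phase' (j : Fin S.numFermions) (y : S.Basis) : ℂ :=
  S.stringSign j y.2 * (if y.2 j then -Complex.I else Complex.I)

/-- The eigenvalues of the parity operator. -/
def parityPhase (y : S.Basis) : ℂ := ∏ j, if y.2 j then -Complex.I else Complex.I

/-- The primitive root of unity of the order of a degree of freedom. -/
noncomputable def clock (a : S.Dof) : ℂ :=
  Complex.exp (2 * Real.pi * Complex.I / (S.dofDim a : ℂ))

/-- The standard flipper: a cyclic shift for a qudit, `γ` for a fermion. -/
def stdX (a : S.Dof) : S.Op := S.monomial (S.shift a) (S.phase a)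

/-- The standard separator. -/
noncomputable def stdZ (a : S.Dof) : S.Op :=
  Matrix.diagonal fun y => S.clock a ^ S.digit a y

/-- The algebra generated by a set of degrees of freedom. -/
def dofAlgebra (N : Set S.Dof) : Subalgebra ℂ S.Op :=
  Algebra.adjoin ℂ
    ({O | ∃ j, Sum.inr j ∈ N ∧ (O = S.majorana j ∨ O = S.majorana' j)} ∪
      {O | ∃ q A, Sum.inl q ∈ N ∧ O = S.quditOp q A})

variable {S}

theorem localAlgebra_eq (Ω : Set Site) : S.localAlgebra Ω = S.dofAlgebra (S.dofSite ⁻¹' Ω) := rfl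

theorem monomial_apply (σ : S.Basis → S.Basis) (s : S.Basis → ℂ) (x y : S.Basis) :
    S.monomial σ s x y = if x = σ y then s y else 0 := rfl

theorem mul_monomial_apply (M : S.Op) (σ : S.Basis → S.Basis) (s : S.Basis → ℂ) (x y : S.Basis) :
    (M * S.monomial σ s) x y = M x (σ y) * s y := by
  rw [Matrix.mul_apply, Finset.sum_eq_single (σ y)]
  · simp [monomial_apply]
  · intro z _ hz
    simp [monomial_apply, hz]
  · simp

theorem monomial_mul_apply {σ : S.Basis → S.Basis} (hσ : Function.Injective σ) (M : S.Op)
    (s : S.Basis → ℂ) (x y : S.Basis) :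
    (S.monomial σ s * M) (σ x) y = s x * M x y := by
  rw [Matrix.mul_apply, Finset.sum_eq_single x]
  · simp [monomial_apply]
  · intro z _ hz
    simp [monomial_apply, hσ.eq_iff, Ne.symm hz]
  · simp

theorem monomial_mul (σ τ : S.Basis → S.Basis) (s t : S.Basis → ℂ) :
    S.monomial σ s * S.monomial τ t = S.monomial (σ ∘ τ) fun y => s (τ y) * t y := by
  ext x y
  rw [mul_monomial_apply]
  simp [monomial_apply]

theorem monomial_id (d : S.Basis → ℂ) : S.monomial id d = Matrix.diagonal d := by
  ext x y
  by_cases h : x = y <;> simp [monomial_apply, Matrix.diagonal, h]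

theorem mul_monomial_eq_iff {σ : S.Basis → S.Basis} (hσ : Function.Bijective σ) (M : S.Op)
    (s t : S.Basis → ℂ) :
    M * S.monomial σ s = S.monomial σ t * M ↔
      ∀ x y, M (σ x) (σ y) * s y = t x * M x y := by
  constructor
  · intro h x y
    rw [← mul_monomial_apply, h, monomial_mul_apply hσ.1]
  · intro h
    ext x y
    obtain ⟨x, rfl⟩ := hσ.2 x
    rw [mul_monomial_apply, h, monomial_mul_apply hσ.1]

theorem mul_diagonal_eq_iff (M : S.Op) (d e : S.Basis → ℂ) :
    M * Matrix.diagonal d = Matrix.diagonal e * M ↔ ∀ x y, M x y * d y = e x * M x y := by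
  rw [← monomial_id, ← monomial_id, mul_monomial_eq_iff Function.bijective_id]
  rfl

theorem monomial_mul_diagonal (σ : S.Basis → S.Basis) (s d : S.Basis → ℂ) :
    S.monomial σ s * Matrix.diagonal d = S.monomial σ fun y => s y * d y := by
  rw [← monomial_id, monomial_mul]; rfl

theorem diagonal_mul_monomial (σ : S.Basis → S.Basis) (s d : S.Basis → ℂ) :
    Matrix.diagonal d * S.monomial σ s = S.monomial σ fun y => d (σ y) * s y := by
  rw [← monomial_id, monomial_mul]; rfl

theorem smul_monomial (c : ℂ) (σ : S.Basis → S.Basis) (s : S.Basis → ℂ) :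
    c • S.monomial σ s = S.monomial σ fun y => c * s y := by
  ext x y
  simp [monomial_apply]

theorem majorana_eq (j : Fin S.numFermions) :
    S.majorana j = S.monomial (S.shift (Sum.inr j)) (S.phase (Sum.inr j)) := by
  ext x y
  simp only [majorana, monomial_apply, Matrix.of_apply, shift, phase, Prod.ext_iff]

theorem majorana'_eq (j : Fin S.numFermions) :
    S.majorana' j = S.monomial (S.shift (Sum.inr j)) (S.phase' j) := by
  ext x y
  simp only [majorana', monomial_apply, Matrix.of_apply, shift, phase', Prod.ext_iff]

theorem stdX_inr (j : Fin S.numFermions) : S.stdX (Sum.inr j) = S.majorana j :=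
  (majorana_eq j).symm

theorem stdX_inl (q : Fin S.numQudits) :
    S.stdX (Sum.inl q) = S.quditOp q (Matrix.of fun k l => if k = l + 1 then 1 else 0) := by
  ext x y
  simp only [stdX, monomial_apply, quditOp, Matrix.of_apply, shift, phase, ← ite_and]
  refine if_congr ?_ rfl rfl
  constructor
  · rintro rfl
    refine ⟨⟨rfl, fun r hr => ?_⟩, ?_⟩
    · simp [Function.update_of_ne hr]
    · simp
  · rintro ⟨⟨h2, h1⟩, h⟩
    refine Prod.ext (funext fun r => ?_) h2
    by_cases hr : r = q
    · subst hr; simp [h]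
    · simp [Function.update_of_ne hr, h1 r hr]

theorem clock_isPrimitiveRoot (a : S.Dof) : IsPrimitiveRoot (S.clock a) (S.dofDim a) :=
  Complex.isPrimitiveRoot_exp _ (by have := S.two_le_dofDim a; omega)

theorem clock_ne_zero (a : S.Dof) : S.clock a ≠ 0 := Complex.exp_ne_zero _

theorem clock_pow_digit_shift (a : S.Dof) (y : S.Basis) :
    S.clock a ^ S.digit a (S.shift a y) = S.clock a * S.clock a ^ S.digit a y := by
  rw [digit_shift_self, ← pow_eq_pow_mod _ (clock_isPrimitiveRoot a).pow_eq_one, pow_succ']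

theorem clock_pow_digit_injective {a : S.Dof} {x y : S.Basis}
    (h : S.clock a ^ S.digit a x = S.clock a ^ S.digit a y) : S.digit a x = S.digit a y :=
  (clock_isPrimitiveRoot a).pow_inj (digit_lt a x) (digit_lt a y) h

theorem clock_inr (j : Fin S.numFermions) : S.clock (Sum.inr j) = -1 := by
  have : IsPrimitiveRoot (S.clock (Sum.inr j)) 2 := clock_isPrimitiveRoot (Sum.inr j)
  exact this.eq_neg_one_of_two_right

theorem quditOp_diagonal (q : Fin S.numQudits) (d : Fin (S.quditDim q) → ℂ) :
    S.quditOp q (Matrix.diagonal d) = Matrix.diagonal fun y => d (y.1 q) := by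
  ext x y
  by_cases hxy : x = y
  · subst hxy; simp [quditOp]
  · rw [Matrix.diagonal_apply_ne _ hxy]
    simp only [quditOp, Matrix.of_apply]
    split_ifs with h
    · refine Matrix.diagonal_apply_ne _ fun e => hxy (Prod.ext (funext fun r => ?_) h.1)
      by_cases hr : r = q
      · subst hr; exact e
      · exact h.2 r hr
    · rfl

theorem stdZ_inl (q : Fin S.numQudits) : S.stdZ (Sum.inl q) = S.pauliZ q := by
  rw [pauliZ, quditOp_diagonal, stdZ]
  congr 1
  funext y
  rw [clock, ← Complex.exp_nat_mul]
  congr 1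
  simp only [dofDim, digit, Sum.elim_inl]
  ring

theorem stringSign_update (j k : Fin S.numFermions) (n : Fin S.numFermions → Bool) :
    S.stringSign j (Function.update n k (!n k)) =
      if k < j then -S.stringSign j n else S.stringSign j n := by
  unfold stringSign
  split_ifs with h
  · have hk : k ∈ Finset.univ.filter (· < j) := by simp [h]
    rw [← Finset.mul_prod_erase _ _ hk, ← Finset.mul_prod_erase _ _ hk, ← neg_mul]
    congr 1
    · cases hn : n k <;> simp
    · refine Finset.prod_congr rfl fun i hi => ?_
      rw [Function.update_of_ne (Finset.ne_of_mem_erase hi)]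
  · refine Finset.prod_congr rfl fun i hi => ?_
    rw [Function.update_of_ne]
    rintro rfl
    exact h (Finset.mem_filter.1 hi).2

theorem stringSign_mul_self (j : Fin S.numFermions) (n : Fin S.numFermions → Bool) :
    S.stringSign j n * S.stringSign j n = 1 := by
  unfold stringSign
  rw [← Finset.prod_mul_distrib]
  exact Finset.prod_eq_one fun i _ => by split_ifs <;> simp

theorem stdZ_inr (j : Fin S.numFermions) :
    S.stdZ (Sum.inr j) = Complex.I • (S.majorana' j * S.majorana j) := by
  rw [majorana_eq, majorana'_eq, monomial_mul, smul_monomial, stdZ, ← monomial_id]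
  congr 1
  · funext y
    exact (shift_iterate_dofDim (Sum.inr j) y).symm
  · funext y
    simp only [phase', phase, shift, stringSign_update, lt_irrefl, if_false, Function.update_self,
      clock_inr, digit]
    have := stringSign_mul_self j y.2
    cases y.2 j
    · simp
      linear_combination -this + (S.stringSign j y.2)^2 * Complex.I_mul_I
    · simp
      linear_combination this - (S.stringSign j y.2)^2 * Complex.I_mul_I

theorem phase_ne_zero (a : S.Dof) (y : S.Basis) : S.phase a y ≠ 0 := by
  rcases a with q | j
  · exact one_ne_zero
  · exact left_ne_zero_of_mul_eq_one (stringSign_mul_self j y.2)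

/-- The string sign sees only fermions of lower rank. Thus the standard flippers are in the same
axial gauge as the eigenbasis, and so is the ratio of the two phases. -/
theorem phase_eq_one {a : S.Dof} {y : S.Basis} (h : ∀ b, S.rank b < S.rank a → S.digit b y = 0) :
    S.phase a y = 1 := by
  rcases a with q | j
  · rfl
  · change ∏ k ∈ Finset.univ.filter (· < j), (if y.2 k then -1 else 1 : ℂ) = 1
    refine Finset.prod_eq_one fun i hi => ?_
    have := h (Sum.inr i) (by have := (Finset.mem_filter.1 hi).2; simp only [rank]; omega)
    cases hy : y.2 i <;> simp_all [digit]

/-- The sign from exchanging the flippers of two different degrees of freedom. -/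
def exchangeSign (S : QuantumSystem Site) : S.Dof → S.Dof → ℂ
  | Sum.inr _, Sum.inr _ => -1
  | _, _ => 1

/-- For two fermions exactly one of the two strings passes through the other mode. Distant flippers
obey the same exchange sign, so it drops out of the ratio of phases and leaves a flat family. -/
theorem phase_exchange {a b : S.Dof} (h : a ≠ b) (y : S.Basis) :
    S.phase a (S.shift b y) * S.phase b y =
      S.exchangeSign a b * (S.phase b (S.shift a y) * S.phase a y) := by
  rcases a with q | j <;> rcases b with r | k <;> simp only [phase, exchangeSign, shift] <;> try simp
  rw [stringSign_update, stringSign_update]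
  rcases lt_trichotomy j k with hjk | hjk | hjk
  · rw [if_neg hjk.not_gt, if_pos hjk]; ring
  · exact absurd (congrArg _ hjk) h
  · rw [if_pos hjk, if_neg hjk.not_gt]; ring

theorem parityPhase_ne_zero (y : S.Basis) : S.parityPhase y ≠ 0 := by
  refine Finset.prod_ne_zero_iff.2 fun j _ => ?_
  split_ifs <;> simp

theorem parityPhase_shift_inl (q : Fin S.numQudits) (y : S.Basis) :
    S.parityPhase (S.shift (Sum.inl q) y) = S.parityPhase y := rfl

theorem parityPhase_shift_inr (j : Fin S.numFermions) (y : S.Basis) :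
    S.parityPhase (S.shift (Sum.inr j) y) = -S.parityPhase y := by
  unfold parityPhase
  rw [← Finset.mul_prod_erase _ _ (Finset.mem_univ j),
    ← Finset.mul_prod_erase _ (fun k => if y.2 k then -Complex.I else Complex.I)
      (Finset.mem_univ j), ← neg_mul]
  congr 1
  · simp only [shift, Function.update_self]
    cases y.2 j <;> simp
  · refine Finset.prod_congr rfl fun i hi => ?_
    have : (S.shift (Sum.inr j) y).2 i = y.2 i :=
      Function.update_of_ne (Finset.ne_of_mem_erase hi) _ _
    rw [this]

theorem majorana_mul_majorana' (j : Fin S.numFermions) :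
    S.majorana j * S.majorana' j =
      Matrix.diagonal fun y => if y.2 j then -Complex.I else Complex.I := by
  rw [majorana_eq, majorana'_eq, monomial_mul, ← monomial_id]
  congr 1
  · funext y
    exact shift_iterate_dofDim (Sum.inr j) y
  · funext y
    simp only [phase', phase, shift, stringSign_update, lt_irrefl, if_false]
    rw [← mul_assoc, stringSign_mul_self, one_mul]

theorem parityOp_eq : S.parityOp = Matrix.diagonal S.parityPhase := by
  have h : (List.ofFn fun j => S.majorana j * S.majorana' j) =
      (List.ofFn fun (j : Fin S.numFermions) (y : S.Basis) =>
        if y.2 j then -Complex.I else Complex.I).map (Matrix.diagonalRingHom S.Basis ℂ) := by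
    rw [List.map_ofFn]
    congr 1
    funext j
    exact majorana_mul_majorana' j
  rw [parityOp, h, ← map_list_prod, List.prod_ofFn, Matrix.diagonalRingHom_apply]
  congr 1
  funext y
  rw [Finset.prod_apply]
  rfl

theorem isUnit_parityOp : IsUnit S.parityOp := by
  rw [parityOp_eq, Matrix.isUnit_diagonal, Pi.isUnit_iff]
  exact fun y => (parityPhase_ne_zero y).isUnit

theorem quditOp_mulVec (q : Fin S.numQudits) (A : Matrix (Fin (S.quditDim q)) (Fin (S.quditDim q)) ℂ)
    (v : S.Basis → ℂ) (x : S.Basis) :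
    (S.quditOp q A).mulVec v x = ∑ k, A (x.1 q) k * v (Function.update x.1 q k, x.2) := by
  symm
  refine Fintype.sum_of_injective (fun k => ((Function.update x.1 q k, x.2) : S.Basis))
    (fun k l h => ?_) _ _ (fun y hy => ?_) fun k => ?_
  · have := congrFun (Prod.ext_iff.1 h).1 q
    simpa using this
  · simp only [quditOp, Matrix.of_apply]
    rw [if_neg, zero_mul]
    rintro ⟨h2, h1⟩
    refine hy ⟨y.1 q, Prod.ext (funext fun r => ?_) h2⟩
    by_cases hr : r = q
    · subst hr; simp
    · simp [Function.update_of_ne hr, h1 r hr]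
  · simp only [quditOp, Matrix.of_apply]
    rw [if_pos ⟨trivial, fun r hr => by simp [Function.update_of_ne hr]⟩]
    simp

theorem quditOp_commute {q r : Fin S.numQudits} (h : q ≠ r)
    (A : Matrix (Fin (S.quditDim q)) (Fin (S.quditDim q)) ℂ)
    (B : Matrix (Fin (S.quditDim r)) (Fin (S.quditDim r)) ℂ) :
    Commute (S.quditOp q A) (S.quditOp r B) := by
  refine Matrix.toLin'.injective (LinearMap.ext fun v => funext fun x => ?_)
  rw [Matrix.toLin'_mul_apply, Matrix.toLin'_mul_apply]
  simp only [Matrix.toLin'_apply, quditOp_mulVec, Finset.mul_sum]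
  rw [Finset.sum_comm]
  refine Finset.sum_congr rfl fun k _ => Finset.sum_congr rfl fun l _ => ?_
  rw [Function.update_of_ne h.symm, Function.update_of_ne h, Function.update_comm h]
  ring

theorem quditOp_commute_shift (q : Fin S.numQudits)
    (A : Matrix (Fin (S.quditDim q)) (Fin (S.quditDim q)) ℂ) (j : Fin S.numFermions)
    {s : S.Basis → ℂ} (hs : ∀ x y : S.Basis, x.2 = y.2 → s x = s y) :
    Commute (S.quditOp q A) (S.monomial (S.shift (Sum.inr j)) s) := by
  refine (mul_monomial_eq_iff (shift_bijective _) _ _ _).2 fun x y => ?_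
  have hiff : Function.update x.2 j (!x.2 j) = Function.update y.2 j (!y.2 j) ↔ x.2 = y.2 := by
    refine ⟨fun h => funext fun k => ?_, fun h => by rw [h]⟩
    have := congrFun h k
    by_cases hk : k = j
    · subst hk; simpa using this
    · simpa [Function.update_of_ne hk] using this
  simp only [quditOp, Matrix.of_apply, shift, hiff]
  split_ifs with h
  · rw [hs x y h.1, mul_comm]
  · simp

theorem quditOp_commute_majorana (q : Fin S.numQudits)
    (A : Matrix (Fin (S.quditDim q)) (Fin (S.quditDim q)) ℂ) (j : Fin S.numFermions) :
    Commute (S.quditOp q A) (S.majorana j) := by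
  rw [majorana_eq]
  exact quditOp_commute_shift q A j fun x y h => by simp [phase, h]

theorem quditOp_commute_majorana' (q : Fin S.numQudits)
    (A : Matrix (Fin (S.quditDim q)) (Fin (S.quditDim q)) ℂ) (j : Fin S.numFermions) :
    Commute (S.quditOp q A) (S.majorana' j) := by
  rw [majorana'_eq]
  exact quditOp_commute_shift q A j fun x y h => by simp [phase', h]

theorem quditOp_commute_parityOp (q : Fin S.numQudits)
    (A : Matrix (Fin (S.quditDim q)) (Fin (S.quditDim q)) ℂ) :
    Commute (S.quditOp q A) S.parityOp := by
  rw [parityOp_eq]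
  refine (mul_diagonal_eq_iff _ _ _).2 fun x y => ?_
  simp only [quditOp, Matrix.of_apply]
  split_ifs with h
  · rw [parityPhase, parityPhase, h.1, mul_comm]
  · simp

theorem monomial_shift_mul_parityOp (j : Fin S.numFermions) (s : S.Basis → ℂ) :
    S.parityOp * S.monomial (S.shift (Sum.inr j)) s =
      -(S.monomial (S.shift (Sum.inr j)) s * S.parityOp) := by
  rw [parityOp_eq, diagonal_mul_monomial, monomial_mul_diagonal, ← neg_one_smul ℂ, smul_monomial]
  congr 1
  funext y
  rw [parityPhase_shift_inr]
  ring

/-! ### Graded commutation of operators with disjoint supports. -/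

theorem isOdd_majorana (j : Fin S.numFermions) : S.IsOdd (S.majorana j) := by
  rw [majorana_eq]; exact monomial_shift_mul_parityOp j _

theorem isOdd_majorana' (j : Fin S.numFermions) : S.IsOdd (S.majorana' j) := by
  rw [majorana'_eq]; exact monomial_shift_mul_parityOp j _

theorem monomial_shift_anticommute {a b : S.Dof} {s t : S.Basis → ℂ}
    (h : ∀ y, s (S.shift b y) * t y = -(t (S.shift a y) * s y)) :
    S.monomial (S.shift a) s * S.monomial (S.shift b) t =
      -(S.monomial (S.shift b) t * S.monomial (S.shift a) s) := by
  rw [monomial_mul, monomial_mul, ← neg_one_smul ℂ, smul_monomial]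
  congr 1
  · funext y; exact shift_comm a b y
  · funext y; rw [h]; ring

theorem majorana_anticommute {j k : Fin S.numFermions} (h : j ≠ k) :
    S.majorana j * S.majorana k = -(S.majorana k * S.majorana j) := by
  rw [majorana_eq, majorana_eq]
  refine monomial_shift_anticommute fun y => ?_
  rw [phase_exchange (by simpa using h)]
  simp [exchangeSign]

theorem phase'_eq (j : Fin S.numFermions) (y : S.Basis) :
    S.phase' j y = S.phase (Sum.inr j) y * (if y.2 j then -Complex.I else Complex.I) := rfl

theorem majorana_anticommute_majorana' {j k : Fin S.numFermions} (h : j ≠ k) :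
    S.majorana j * S.majorana' k = -(S.majorana' k * S.majorana j) := by
  rw [majorana_eq, majorana'_eq]
  refine monomial_shift_anticommute fun y => ?_
  have := phase_exchange (S := S) (a := Sum.inr j) (b := Sum.inr k) (by simpa using h) y
  rw [phase'_eq, phase'_eq, ← mul_assoc, this]
  simp only [exchangeSign, shift, Function.update_of_ne h.symm]
  ring

theorem majorana'_anticommute {j k : Fin S.numFermions} (h : j ≠ k) :
    S.majorana' j * S.majorana' k = -(S.majorana' k * S.majorana' j) := by
  rw [majorana'_eq, majorana'_eq]
  refine monomial_shift_anticommute fun y => ?_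
  have := phase_exchange (S := S) (a := Sum.inr j) (b := Sum.inr k) (by simpa using h) y
  simp only [phase'_eq, exchangeSign, shift, Function.update_of_ne h.symm,
    Function.update_of_ne h] at this ⊢
  linear_combination (if y.2 j then -Complex.I else Complex.I) *
    (if y.2 k then -Complex.I else Complex.I) * this

/-- Moving `B` past the parity operator produces a second sign, which cancels the one from `A`. This
is how Majorana operators are made to commute with the other degrees of freedom. -/
theorem commute_of_anticommute_of_isOdd {A B : S.Op} (h : A * B = -(B * A)) (hB : S.IsOdd B) :
    Commute (A * S.parityOp) B := by
  have hB' : S.parityOp * B = -(B * S.parityOp) := hB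
  change A * S.parityOp * B = B * (A * S.parityOp)
  rw [mul_assoc, hB', mul_neg, ← mul_assoc, h, neg_mul, neg_neg, mul_assoc]

/-- The Majorana operators times the parity operator commute with the other degrees of freedom. -/
theorem commute_dofAlgebra_of_notMem {N : Set S.Dof} {Q : S.Op} (hQ : Q ∈ S.dofAlgebra N) :
    (∀ q A, Sum.inl q ∉ N → Commute (S.quditOp q A) Q) ∧
    (∀ j, Sum.inr j ∉ N → Commute (S.majorana j * S.parityOp) Q ∧
      Commute (S.majorana' j * S.parityOp) Q) := by
  have gen : ∀ T : S.Op, (∀ q A, Sum.inl q ∈ N → Commute T (S.quditOp q A)) →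
      (∀ j, Sum.inr j ∈ N → Commute T (S.majorana j) ∧ Commute T (S.majorana' j)) →
      Commute T Q := by
    intro T h1 h2
    have : Q ∈ Subalgebra.centralizer ℂ {T} := by
      refine Algebra.adjoin_le ?_ hQ
      rintro O (⟨j, hj, rfl | rfl⟩ | ⟨q, A, hq, rfl⟩) <;>
        simp only [SetLike.mem_coe, Subalgebra.mem_centralizer_iff, Set.mem_singleton_iff,
          forall_eq]
      · exact (h2 j hj).1
      · exact (h2 j hj).2
      · exact h1 q A hq
    exact (Subalgebra.mem_centralizer_iff ℂ).1 this T rfl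
  refine ⟨fun q A hq => gen _ (fun r B hr => ?_) fun k hk => ?_, fun j hj => ⟨?_, ?_⟩⟩
  · exact quditOp_commute (by rintro rfl; exact hq hr) A B
  · exact ⟨quditOp_commute_majorana q A k, quditOp_commute_majorana' q A k⟩
  · refine gen _ (fun r B hr => ?_) fun k hk => ?_
    · exact ((quditOp_commute_majorana r B j).mul_right (quditOp_commute_parityOp r B)).symm
    · have hjk : j ≠ k := by rintro rfl; exact hj hk
      exact ⟨commute_of_anticommute_of_isOdd (majorana_anticommute hjk) (isOdd_majorana k),
        commute_of_anticommute_of_isOdd (majorana_anticommute_majorana' hjk) (isOdd_majorana' k)⟩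
  · refine gen _ (fun r B hr => ?_) fun k hk => ?_
    · exact ((quditOp_commute_majorana' r B j).mul_right (quditOp_commute_parityOp r B)).symm
    · have hjk : j ≠ k := by rintro rfl; exact hj hk
      refine ⟨commute_of_anticommute_of_isOdd ?_ (isOdd_majorana k),
        commute_of_anticommute_of_isOdd (majorana'_anticommute hjk) (isOdd_majorana' k)⟩
      rw [majorana_anticommute_majorana' hjk.symm, neg_neg]

theorem commute_of_commute_mul_parityOp_of_isEven {G Q : S.Op} (hQ : S.IsEven Q)
    (h : Commute (G * S.parityOp) Q) : Commute G Q := by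
  refine isUnit_parityOp.mul_right_cancel ?_
  have hQ' : S.parityOp * Q = Q * S.parityOp := hQ
  have h' : G * S.parityOp * Q = Q * (G * S.parityOp) := h
  rw [mul_assoc, ← hQ', ← mul_assoc, h', mul_assoc]

theorem commute_mul_parityOp_of_isOdd {G Q : S.Op} (hG : S.IsOdd G) (hQ : S.IsOdd Q)
    (h : Commute (G * S.parityOp) Q) : Commute G (Q * S.parityOp) := by
  have hQ' : S.parityOp * Q = -(Q * S.parityOp) := hQ
  have hG' : S.parityOp * G = -(G * S.parityOp) := hG
  have h' : G * S.parityOp * Q = Q * (G * S.parityOp) := h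
  change G * (Q * S.parityOp) = Q * S.parityOp * G
  rw [mul_assoc Q, hG', mul_neg, ← h', mul_assoc, hQ', mul_neg, neg_neg]

/-- Every parity-twisted Majorana operator outside `N'` commutes with `Q`, and the twist can be
removed because `Q` is even. Checking generators suffices, so `O` may have mixed parity. -/
theorem commute_of_isEven {N N' : Set S.Dof} (hN : Disjoint N N') {O Q : S.Op}
    (hO : O ∈ S.dofAlgebra N) (hQ : Q ∈ S.dofAlgebra N') (hQe : S.IsEven Q) : Commute O Q := by
  have hd := commute_dofAlgebra_of_notMem hQ
  have : O ∈ Subalgebra.centralizer ℂ {Q} := by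
    refine Algebra.adjoin_le ?_ hO
    rintro O (⟨j, hj, rfl | rfl⟩ | ⟨q, A, hq, rfl⟩) <;>
      simp only [SetLike.mem_coe, Subalgebra.mem_centralizer_iff, Set.mem_singleton_iff,
        forall_eq]
    · exact (commute_of_commute_mul_parityOp_of_isEven hQe
        (hd.2 j (Set.disjoint_left.1 hN hj)).1).symm
    · exact (commute_of_commute_mul_parityOp_of_isEven hQe
        (hd.2 j (Set.disjoint_left.1 hN hj)).2).symm
    · exact (hd.1 q A (Set.disjoint_left.1 hN hq)).symm
  exact ((Subalgebra.mem_centralizer_iff ℂ).1 this Q rfl).symm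

/-- Substitute for anticommutation that also applies to `O` of mixed parity: the twist is moved from
the generators of the algebra of `O` onto `Q`. -/
theorem commute_mul_parityOp {N N' : Set S.Dof} (hN : Disjoint N N') {O Q : S.Op}
    (hO : O ∈ S.dofAlgebra N) (hQ : Q ∈ S.dofAlgebra N') (hQo : S.IsOdd Q) :
    Commute O (Q * S.parityOp) := by
  have hd := commute_dofAlgebra_of_notMem hQ
  have : O ∈ Subalgebra.centralizer ℂ {Q * S.parityOp} := by
    refine Algebra.adjoin_le ?_ hO
    rintro O (⟨j, hj, rfl | rfl⟩ | ⟨q, A, hq, rfl⟩) <;>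
      simp only [SetLike.mem_coe, Subalgebra.mem_centralizer_iff, Set.mem_singleton_iff,
        forall_eq]
    · exact (commute_mul_parityOp_of_isOdd (isOdd_majorana j) hQo
        (hd.2 j (Set.disjoint_left.1 hN hj)).1).symm
    · exact (commute_mul_parityOp_of_isOdd (isOdd_majorana' j) hQo
        (hd.2 j (Set.disjoint_left.1 hN hj)).2).symm
    · exact ((hd.1 q A (Set.disjoint_left.1 hN hq)).mul_right
        (quditOp_commute_parityOp q A)).symm
  exact ((Subalgebra.mem_centralizer_iff ℂ).1 this _ rfl).symm

theorem anticommute_of_isOdd {N N' : Set S.Dof} (hN : Disjoint N N') {O Q : S.Op}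
    (hO : O ∈ S.dofAlgebra N) (hQ : Q ∈ S.dofAlgebra N') (hOo : S.IsOdd O) (hQo : S.IsOdd Q) :
    O * Q = -(Q * O) := by
  have h : O * (Q * S.parityOp) = Q * S.parityOp * O := commute_mul_parityOp hN hO hQ hQo
  have hO' : S.parityOp * O = -(O * S.parityOp) := hOo
  refine isUnit_parityOp.mul_right_cancel ?_
  rw [mul_assoc, h, mul_assoc, hO', mul_neg, neg_mul, mul_assoc]

end QuantumSystem

/-! ### Clock and shift decomposition relative to one degree of freedom. -/

section ClockShift

variable {R : Type*} [Ring R] {D : ℕ}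

/-- A component of `M` in the clock and shift decomposition. -/
def clockShiftComponent (p : ZMod D → R) (u X : Rˣ) (M : R) (k : ℕ) (l : ZMod D) : R :=
  ∑ j ∈ Finset.range D, ((u ^ j : Rˣ) : R) * (p l * M * ((X ^ k)⁻¹ : Rˣ) * p l) * ((u ^ j)⁻¹ : Rˣ)

variable {p : ZMod D → R} {u X : Rˣ}

theorem pow_mul_projection (hX : ∀ i, (X : R) * p i = p (i + 1) * X) (k : ℕ) (i : ZMod D) :
    ((X ^ k : Rˣ) : R) * p i = p (i + k) * (X ^ k : Rˣ) := by
  induction k with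
  | zero => simp
  | succ k ih =>
    rw [pow_succ', Units.val_mul, mul_assoc, ih, ← mul_assoc, hX, mul_assoc, Nat.cast_succ,
      add_assoc]

theorem inv_pow_mul_projection (hX : ∀ i, (X : R) * p i = p (i + 1) * X) (k : ℕ) (i : ZMod D) :
    (((X ^ k)⁻¹ : Rˣ) : R) * p (i + k) = p i * ((X ^ k)⁻¹ : Rˣ) := by
  rw [Units.inv_mul_eq_iff_eq_mul, ← mul_assoc, pow_mul_projection hX, mul_assoc, Units.mul_inv,
    mul_one]

/-- The conjugate by `u ^ j` lives in the block `l + j`, so multiplication by `p l` keeps only `j =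
0`, leaving the block `p l * M * p (l - k)`; the blocks add up to `M`. Two raising operators are
needed: `X` belongs to the degree of freedom being split off, while averaging over `u`, its
parity-twisted version in the fermionic case, makes the coefficients commute with `u`. -/
theorem sum_clockShiftComponent [NeZero D] (hp : ∀ i j, p i * p j = if i = j then p i else 0)
    (hsum : ∑ i, p i = 1) (hu : ∀ i, (u : R) * p i = p (i + 1) * u)
    (hX : ∀ i, (X : R) * p i = p (i + 1) * X) (M : R) :
    ∑ k : ZMod D, ∑ l, clockShiftComponent p u X M k.val l * (p l * (X ^ k.val : Rˣ)) = M := by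
  have h1 : ∀ (k l : ZMod D), clockShiftComponent p u X M k.val l * (p l * (X ^ k.val : Rˣ)) =
      p l * M * p (l - k) := by
    intro k l
    rw [clockShiftComponent, Finset.sum_mul, Finset.sum_eq_single 0]
    · have h := inv_pow_mul_projection hX k.val (l - k)
      rw [ZMod.natCast_zmod_val, sub_add_cancel] at h
      simp only [pow_zero, Units.val_one, one_mul, inv_one, mul_one]
      rw [mul_assoc _ (p l), ← mul_assoc (p l) (p l), hp, if_pos rfl, mul_assoc (p l * M),
        ← mul_assoc _ (p l), h, mul_assoc (p (l - k)), Units.inv_mul, mul_one]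
    · intro j hj hj0
      have h := inv_pow_mul_projection hu j (l - j)
      rw [sub_add_cancel] at h
      rw [← mul_assoc, mul_assoc _ _ (p l), h]
      have : p l * p (l - (j : ZMod D)) = 0 := by
        rw [hp, if_neg]
        intro e
        have h0 : (j : ZMod D) = 0 := by simpa using sub_eq_self.1 e.symm
        rw [ZMod.natCast_eq_zero_iff] at h0
        exact hj0 (Nat.eq_zero_of_dvd_of_lt h0 (Finset.mem_range.1 hj))
      have h0 : ∀ B, p l * (p (l - (j : ZMod D)) * B) = 0 := fun B => by
        rw [← mul_assoc, this, zero_mul]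
      simp only [mul_assoc, h0, mul_zero, zero_mul]
    · intro h; exact absurd (Finset.mem_range.2 (NeZero.pos D)) h
  simp only [h1]
  rw [Finset.sum_comm]
  simp only [← Finset.mul_sum]
  have h2 : ∀ l : ZMod D, ∑ k, p (l - k) = 1 := by
    intro l
    rw [← hsum]
    exact Fintype.sum_equiv (Equiv.subLeft l) _ _ fun _ => rfl
  simp only [h2, mul_one, ← Finset.sum_mul, hsum, one_mul]

theorem commute_projection_clockShiftComponent
    (hp : ∀ i j, p i * p j = if i = j then p i else 0)
    (hu : ∀ i, (u : R) * p i = p (i + 1) * u) (M : R) (k : ℕ) (l i : ZMod D) :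
    Commute (p i) (clockShiftComponent p u X M k l) := by
  refine Commute.sum_right _ _ _ fun j _ => ?_
  have h1 := pow_mul_projection hu j (i - j)
  have h2 := inv_pow_mul_projection hu j (i - j)
  rw [sub_add_cancel] at h1 h2
  have h3 : Commute (p (i - j)) (p l * M * ((X ^ k)⁻¹ : Rˣ) * p l) := by
    change p (i - j) * (p l * M * ((X ^ k)⁻¹ : Rˣ) * p l) =
      p l * M * ((X ^ k)⁻¹ : Rˣ) * p l * p (i - j)
    rw [← mul_assoc, ← mul_assoc, ← mul_assoc, hp, mul_assoc _ (p l) (p (i - j)), hp]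
    by_cases h : i - j = l
    · rw [if_pos h, if_pos h.symm, h]
    · rw [if_neg h, if_neg (Ne.symm h)]; simp
  generalize p l * M * ((X ^ k)⁻¹ : Rˣ) * p l = A at h3
  change p i * (_ * A * _) = _ * A * _ * p i
  rw [mul_assoc _ _ (p i), h2, ← mul_assoc, ← mul_assoc, ← h1, mul_assoc _ (p (i - j)) A, h3.eq]
  simp only [mul_assoc]

/-- Conjugation by `u` permutes the terms of the sum cyclically, the last returning to the first
because `u ^ D` is central. -/
theorem commute_unit_clockShiftComponent (hD : ∀ A, Commute ((u ^ D : Rˣ) : R) A)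
    (M : R) (k : ℕ) (l : ZMod D) :
    Commute (u : R) (clockShiftComponent p u X M k l) := by
  set A := p l * M * ((X ^ k)⁻¹ : Rˣ) * p l with hA
  set f : ℕ → R := fun j => ((u ^ j : Rˣ) : R) * A * ((u ^ j)⁻¹ : Rˣ) with hf
  have hc : clockShiftComponent p u X M k l = ∑ j ∈ Finset.range D, f j := rfl
  have h1 : ∀ j, (u : R) * f j = f (j + 1) * u := by
    intro j
    simp only [hf, pow_succ', mul_inv_rev, Units.val_mul, mul_assoc, Units.inv_mul, mul_one]
  have h2 : f D = f 0 := by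
    simp only [hf]
    rw [(hD A).eq, mul_assoc, Units.mul_inv]
    simp
  have h3 : ∑ j ∈ Finset.range D, f (j + 1) = ∑ j ∈ Finset.range D, f j := by
    have := Finset.sum_range_succ' f D
    rw [Finset.sum_range_succ, h2] at this
    exact (add_right_cancel this).symm
  rw [hc]
  change (u : R) * _ = _ * (u : R)
  rw [Finset.mul_sum]
  simp only [h1]
  rw [← Finset.sum_mul, h3]

/-- An anticommuting `u` does no harm, since it occurs in each term together with its inverse. That
case arises for two parity-twisted Majorana operators. -/
theorem commute_clockShiftComponent {T M : R} (hTp : ∀ i, Commute T (p i)) (hTX : Commute T X)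
    (hTu : T * u = u * T ∨ T * u = -(u * T)) (hTM : Commute T M) (k : ℕ) (l : ZMod D) :
    Commute T (clockShiftComponent p u X M k l) := by
  refine Commute.sum_right _ _ _ fun j _ => ?_
  have hA : Commute T (p l * M * ((X ^ k)⁻¹ : Rˣ) * p l) := by
    have hXk : Commute T ((X ^ k : Rˣ) : R) := by
      rw [Units.val_pow_eq_pow_val]; exact hTX.pow_right k
    exact (((hTp l).mul_right hTM).mul_right hXk.units_inv_right).mul_right (hTp l)
  generalize p l * M * ((X ^ k)⁻¹ : Rˣ) * p l = A at hA
  have step : ∀ B : R, Commute T B → Commute T (u * B * (u⁻¹ : Rˣ)) := by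
    intro B hB
    rcases hTu with h | h
    · have h' : Commute T u := h
      exact (h'.mul_right hB).mul_right h'.units_inv_right
    · have h' : T * (u⁻¹ : Rˣ) = -((u⁻¹ : Rˣ) * T) := by
        have := congrArg (fun z => ((u⁻¹ : Rˣ) : R) * z * (u⁻¹ : Rˣ)) h
        simp only [mul_assoc, Units.mul_inv, mul_one, neg_mul, mul_neg] at this
        rw [← mul_assoc ((u⁻¹ : Rˣ) : R) (u : R), Units.inv_mul, one_mul] at this
        rw [this, neg_neg]
      change T * (u * B * (u⁻¹ : Rˣ)) = u * B * (u⁻¹ : Rˣ) * T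
      rw [← mul_assoc, ← mul_assoc, h, neg_mul, neg_mul, mul_assoc (u : R) T B, hB.eq,
        mul_assoc, mul_assoc B, h', mul_assoc, mul_assoc]
      simp
  clear * - hA step
  induction j with
  | zero => simpa using hA
  | succ j ih =>
    have := step _ ih
    simpa only [pow_succ', mul_inv_rev, Units.val_mul, mul_assoc] using this

end ClockShift

/-! ### Local algebras as commutants of distant clocks and twisted flippers. -/

namespace QuantumSystem

variable {Site : Type*} (S : QuantumSystem Site)

/-- The standard flipper, times the parity operator for a fermion: it commutes with all operators
of the other degrees of freedom. -/
def twistX : S.Dof → S.Op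
  | Sum.inl q => S.stdX (Sum.inl q)
  | Sum.inr j => S.stdX (Sum.inr j) * S.parityOp

/-- The projection on the states in which the label of `a` is `i`. -/
def digitProj (a : S.Dof) (i : ZMod (S.dofDim a)) : S.Op :=
  Matrix.diagonal fun y => if (S.digit a y : ZMod (S.dofDim a)) = i then 1 else 0

variable {S}

instance dofDim_neZero (a : S.Dof) : NeZero (S.dofDim a) :=
  ⟨by have := S.two_le_dofDim a; omega⟩

theorem isUnit_monomial {σ : S.Basis → S.Basis} (hσ : Function.Bijective σ) {s : S.Basis → ℂ}
    (hs : ∀ y, s y ≠ 0) : IsUnit (S.monomial σ s) := by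
  let e := Equiv.ofBijective σ hσ
  have h : S.monomial σ s * S.monomial e.symm (fun y => (s (e.symm y))⁻¹) = 1 := by
    rw [monomial_mul, ← Matrix.diagonal_one, ← monomial_id]
    congr 1
    · funext y; exact e.apply_symm_apply y
    · funext y; exact mul_inv_cancel₀ (hs _)
  exact IsUnit.of_mul_eq_one _ h

theorem isUnit_stdX (a : S.Dof) : IsUnit (S.stdX a) :=
  isUnit_monomial (shift_bijective a) (phase_ne_zero a)

theorem isUnit_twistX (a : S.Dof) : IsUnit (S.twistX a) := by
  rcases a with q | j
  · exact isUnit_stdX _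
  · exact (isUnit_stdX _).mul isUnit_parityOp

theorem digitProj_mul (a : S.Dof) (i j : ZMod (S.dofDim a)) :
    S.digitProj a i * S.digitProj a j = if i = j then S.digitProj a i else 0 := by
  rw [digitProj, digitProj, Matrix.diagonal_mul_diagonal]
  split_ifs with h
  · subst h; simp
  · rw [← Matrix.diagonal_zero]
    congr 1
    funext y
    by_cases h1 : (S.digit a y : ZMod (S.dofDim a)) = i
    · simp [h1, h]
    · simp [h1]

theorem sum_digitProj (a : S.Dof) : ∑ i, S.digitProj a i = 1 := by
  ext x y
  rw [Matrix.sum_apply]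
  by_cases h : x = y
  · subst h; simp [digitProj]
  · simp [digitProj, h]

theorem stdX_mul_digitProj (a : S.Dof) (i : ZMod (S.dofDim a)) :
    S.stdX a * S.digitProj a i = S.digitProj a (i + 1) * S.stdX a := by
  rw [stdX, digitProj, digitProj, monomial_mul_diagonal, diagonal_mul_monomial]
  congr 1
  funext y
  rw [digit_shift_self, ZMod.natCast_mod, Nat.cast_succ, mul_comm]
  simp

theorem digitProj_commute (a b : S.Dof) (i : ZMod (S.dofDim a)) (j : ZMod (S.dofDim b)) :
    Commute (S.digitProj a i) (S.digitProj b j) := by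
  change _ * _ = _ * _
  rw [digitProj, digitProj, Matrix.diagonal_mul_diagonal, Matrix.diagonal_mul_diagonal]
  simp only [mul_comm]

theorem digitProj_commute_stdX {a c : S.Dof} (h : c ≠ a) (i : ZMod (S.dofDim c)) :
    Commute (S.digitProj c i) (S.stdX a) := by
  change _ * _ = _ * _
  rw [stdX, digitProj, monomial_mul_diagonal, diagonal_mul_monomial]
  congr 1
  funext y
  rw [digit_shift_of_ne h, mul_comm]

theorem digitProj_commute_parityOp (c : S.Dof) (i : ZMod (S.dofDim c)) :
    Commute (S.digitProj c i) S.parityOp := by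
  change _ * _ = _ * _
  rw [parityOp_eq, digitProj, Matrix.diagonal_mul_diagonal, Matrix.diagonal_mul_diagonal]
  simp only [mul_comm]

theorem twistX_mul_digitProj (a : S.Dof) (i : ZMod (S.dofDim a)) :
    S.twistX a * S.digitProj a i = S.digitProj a (i + 1) * S.twistX a := by
  rcases a with q | j
  · exact stdX_mul_digitProj _ i
  · rw [twistX, mul_assoc, ← (digitProj_commute_parityOp _ i).eq, ← mul_assoc,
      stdX_mul_digitProj, mul_assoc]

theorem digitProj_commute_twistX {a c : S.Dof} (h : c ≠ a) (i : ZMod (S.dofDim c)) :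
    Commute (S.digitProj c i) (S.twistX a) := by
  rcases a with q | j
  · exact digitProj_commute_stdX h i
  · exact (digitProj_commute_stdX h i).mul_right (digitProj_commute_parityOp c i)

theorem majorana_mem {N : Set S.Dof} {j : Fin S.numFermions} (h : Sum.inr j ∈ N) :
    S.majorana j ∈ S.dofAlgebra N :=
  Algebra.subset_adjoin (Or.inl ⟨j, h, Or.inl rfl⟩)

theorem majorana'_mem {N : Set S.Dof} {j : Fin S.numFermions} (h : Sum.inr j ∈ N) :
    S.majorana' j ∈ S.dofAlgebra N :=
  Algebra.subset_adjoin (Or.inl ⟨j, h, Or.inr rfl⟩)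

theorem quditOp_mem {N : Set S.Dof} {q : Fin S.numQudits} (h : Sum.inl q ∈ N)
    (A : Matrix (Fin (S.quditDim q)) (Fin (S.quditDim q)) ℂ) :
    S.quditOp q A ∈ S.dofAlgebra N :=
  Algebra.subset_adjoin (Or.inr ⟨q, A, h, rfl⟩)

theorem dofAlgebra_mono {N N' : Set S.Dof} (h : N ⊆ N') : S.dofAlgebra N ≤ S.dofAlgebra N' := by
  refine Algebra.adjoin_le ?_
  rintro O (⟨j, hj, rfl | rfl⟩ | ⟨q, A, hq, rfl⟩)
  · exact majorana_mem (h hj)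
  · exact majorana'_mem (h hj)
  · exact quditOp_mem (h hq) A

theorem stdX_mem {N : Set S.Dof} {a : S.Dof} (h : a ∈ N) : S.stdX a ∈ S.dofAlgebra N := by
  rcases a with q | j
  · rw [stdX_inl]; exact quditOp_mem h _
  · rw [stdX_inr]; exact majorana_mem h

theorem stdZ_mem {N : Set S.Dof} {a : S.Dof} (h : a ∈ N) : S.stdZ a ∈ S.dofAlgebra N := by
  rcases a with q | j
  · rw [stdZ_inl]; exact quditOp_mem h _
  · rw [stdZ_inr]
    exact Subalgebra.smul_mem _ (mul_mem (majorana'_mem h) (majorana_mem h)) _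

/-- The projection is a discrete Fourier sum of powers of the clock operator. -/
theorem digitProj_mem {N : Set S.Dof} {a : S.Dof} (h : a ∈ N) (i : ZMod (S.dofDim a)) :
    S.digitProj a i ∈ S.dofAlgebra N := by
  have hc := clock_isPrimitiveRoot a
  have hD : (S.dofDim a : ℂ) ≠ 0 := Nat.cast_ne_zero.2 (NeZero.ne _)
  have : S.digitProj a i = ∑ k ∈ Finset.range (S.dofDim a),
      ((S.dofDim a : ℂ)⁻¹ * ((S.clock a)⁻¹ ^ i.val) ^ k) • S.stdZ a ^ k := by
    ext x y
    rw [Matrix.sum_apply]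
    simp only [stdZ, Matrix.diagonal_pow, Matrix.smul_apply, smul_eq_mul]
    by_cases hxy : x = y
    · subst hxy
      simp only [digitProj, Matrix.diagonal_apply_eq, Pi.pow_apply, mul_assoc, ← mul_pow,
        ← Finset.mul_sum]
      split_ifs with h
      · have hv : i.val = S.digit a x := by
          rw [← h, ZMod.val_natCast, Nat.mod_eq_of_lt (digit_lt a x)]
        rw [hv, ← mul_pow, inv_mul_cancel₀ (clock_ne_zero a)]
        simp [hD]
      · set w := (S.clock a)⁻¹ ^ i.val * S.clock a ^ S.digit a x with hw
        have hw1 : w ≠ 1 := by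
          intro e
          rw [hw, inv_pow, inv_mul_eq_one₀ (pow_ne_zero _ (clock_ne_zero a))] at e
          have := hc.pow_inj (ZMod.val_lt i) (digit_lt a x) e
          exact h (by rw [← this, ZMod.natCast_zmod_val])
        have hwD : w ^ S.dofDim a = 1 := by
          rw [hw, mul_pow, pow_right_comm, pow_right_comm (S.clock a), inv_pow, hc.pow_eq_one]
          simp
        have : (∑ k ∈ Finset.range (S.dofDim a), w ^ k) * (w - 1) = 0 := by
          rw [geom_sum_mul, hwD, sub_self]
        rw [(mul_eq_zero.1 this).resolve_right (sub_ne_zero.2 hw1), mul_zero]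
    · simp [digitProj, Matrix.diagonal_apply_ne _ hxy]
  rw [this]
  exact sum_mem fun k _ => Subalgebra.smul_mem _ (pow_mem (stdZ_mem h) k) _

theorem twistX_commute_of_mem {N : Set S.Dof} {c : S.Dof} (hc : c ∉ N) {Q : S.Op}
    (hQ : Q ∈ S.dofAlgebra N) : Commute (S.twistX c) Q := by
  have := commute_dofAlgebra_of_notMem hQ
  rcases c with q | j
  · rw [twistX, stdX_inl]; exact this.1 q _ hc
  · rw [twistX, stdX_inr]; exact (this.2 j hc).1

theorem twistX_mul_twistX {a c : S.Dof} (h : c ≠ a) :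
    S.twistX c * S.twistX a = S.twistX a * S.twistX c ∨
      S.twistX c * S.twistX a = -(S.twistX a * S.twistX c) := by
  have hX : Commute (S.twistX c) (S.stdX a) :=
    twistX_commute_of_mem (N := {a}) h (stdX_mem rfl)
  rcases a with q | j
  · exact Or.inl hX
  rcases c with r | k
  · refine Or.inl (hX.mul_right ?_)
    rw [twistX, stdX_inl]
    exact quditOp_commute_parityOp _ _
  · right
    have hk : S.parityOp * S.stdX (Sum.inr k) = -(S.stdX (Sum.inr k) * S.parityOp) := by
      rw [stdX_inr]; exact isOdd_majorana k
    have hP : S.twistX (Sum.inr k) * S.parityOp = -(S.parityOp * S.twistX (Sum.inr k)) := by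
      rw [twistX, ← mul_assoc, hk, neg_mul, neg_neg]
    change S.twistX (Sum.inr k) * (S.stdX (Sum.inr j) * S.parityOp) =
      -(S.stdX (Sum.inr j) * S.parityOp * S.twistX (Sum.inr k))
    rw [← mul_assoc, hX.eq, mul_assoc, hP, mul_neg, mul_assoc]

theorem monomial_one_pow (σ : S.Basis → S.Basis) (k : ℕ) :
    S.monomial σ (fun _ => 1) ^ k = S.monomial σ^[k] fun _ => 1 := by
  induction k with
  | zero => rw [pow_zero, Function.iterate_zero, monomial_id, ← Matrix.diagonal_one]
  | succ k ih => rw [pow_succ, ih, monomial_mul, Function.iterate_succ]; simp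

/-- The power is the identity for a qudit. For a fermion it is minus the square of the parity
operator, which is a sign. -/
theorem twistX_pow_commute (a : S.Dof) (A : S.Op) : Commute (S.twistX a ^ S.dofDim a) A := by
  rcases a with q | j
  · have : S.twistX (Sum.inl q) ^ S.dofDim (Sum.inl q) = 1 := by
      change S.monomial _ (fun _ => 1) ^ _ = 1
      rw [monomial_one_pow, ← Matrix.diagonal_one, ← monomial_id]
      congr 1
      funext y
      exact shift_iterate_dofDim _ y
    rw [this]
    exact Commute.one_left A
  · have h1 : S.majorana j * S.majorana j = 1 := by
      rw [majorana_eq, monomial_mul, ← Matrix.diagonal_one, ← monomial_id]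
      congr 1
      · funext y
        exact shift_iterate_dofDim (Sum.inr j) y
      · funext y
        simp only [phase, shift, stringSign_update, lt_irrefl, if_false, stringSign_mul_self]
    have h2 : S.parityOp * S.parityOp = ((-1 : ℂ) ^ S.numFermions) • (1 : S.Op) := by
      rw [parityOp_eq, Matrix.diagonal_mul_diagonal, Matrix.smul_one_eq_diagonal]
      congr 1
      funext y
      rw [parityPhase, ← Finset.prod_mul_distrib, Finset.prod_congr rfl (g := fun _ => -1)]
      · simp
      · intro j _
        split_ifs <;> simp
    have h3 : S.twistX (Sum.inr j) ^ S.dofDim (Sum.inr j) =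
        (-(-1 : ℂ) ^ S.numFermions) • (1 : S.Op) := by
      change (S.stdX (Sum.inr j) * S.parityOp) ^ 2 = _
      have hodd : S.parityOp * S.majorana j = -(S.majorana j * S.parityOp) := isOdd_majorana j
      rw [stdX_inr, pow_two, mul_assoc, ← mul_assoc S.parityOp, hodd, neg_mul, mul_neg, mul_assoc,
        h2, ← mul_assoc, h1, one_mul, neg_smul]
    rw [h3]
    exact (Commute.one_left A).smul_left _

/-- For empty `N` the projections make `M` diagonal and the twisted flippers make it constant. To
adjoin `a`, expand `M` in clocks and shifts of `a`: the coefficients commute with the projections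
and the twisted flipper of `a` by construction, inherit commutation with those outside, and so fall
under the induction hypothesis. -/
theorem mem_dofAlgebra_of_commute_digitProj (N : Finset S.Dof) : ∀ {M : S.Op},
    (∀ a ∉ N, ∀ i, Commute (S.digitProj a i) M) → (∀ a ∉ N, Commute (S.twistX a) M) →
    M ∈ S.dofAlgebra (N : Set S.Dof) := by
  classical
  induction N using Finset.induction_on with
  | empty =>
    intro M hp hX
    have hdiag : ∀ x y, x ≠ y → M x y = 0 := by
      intro x y hxy
      obtain ⟨a, ha⟩ : ∃ a, S.digit a x ≠ S.digit a y := by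
        by_contra h
        push Not at h
        exact hxy (basis_ext h)
      have h := congrFun (congrFun (hp a (Finset.notMem_empty a) (S.digit a x)).eq x) y
      rw [digitProj, Matrix.diagonal_mul, Matrix.mul_diagonal, if_pos rfl, one_mul, if_neg,
        mul_zero] at h
      · exact h
      · intro e
        rw [ZMod.natCast_eq_natCast_iff'] at e
        rw [Nat.mod_eq_of_lt (digit_lt a x), Nat.mod_eq_of_lt (digit_lt a y)] at e
        exact ha e.symm
    obtain ⟨d, rfl⟩ : ∃ d, M = Matrix.diagonal d :=
      ⟨fun y => M y y, by
        ext x y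
        by_cases h : x = y
        · subst h; simp
        · rw [Matrix.diagonal_apply_ne _ h, hdiag x y h]⟩
    have hshift : ∀ a ∈ (Set.univ : Set S.Dof), ∀ y, d (S.shift a y) = d y := by
      intro a _ y
      have h := (hX a (Finset.notMem_empty a)).symm.eq
      have hm : ∃ g : S.Basis → ℂ, (∀ y, g y ≠ 0) ∧ S.twistX a = S.monomial (S.shift a) g := by
        rcases a with q | j
        · exact ⟨_, phase_ne_zero _, rfl⟩
        · refine ⟨_, fun y => mul_ne_zero (phase_ne_zero (Sum.inr j) y) (parityPhase_ne_zero y), ?_⟩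
          rw [twistX, parityOp_eq, stdX, monomial_mul_diagonal]
      obtain ⟨g, hg, hgX⟩ := hm
      rw [hgX, mul_monomial_eq_iff (shift_bijective a)] at h
      have := h y y
      rw [Matrix.diagonal_apply_eq, Matrix.diagonal_apply_eq, mul_comm] at this
      exact mul_left_cancel₀ (hg y) this
    have : Matrix.diagonal d = algebraMap ℂ S.Op (d S.vacuum) := by
      rw [Matrix.algebraMap_eq_diagonal]
      congr 1
      funext y
      exact eq_of_shift_invariant hshift y S.vacuum fun a ha => absurd (Set.mem_univ a) ha
    rw [this]
    exact Subalgebra.algebraMap_mem _ _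
  | insert a N haN ih =>
    intro M hp hX
    obtain ⟨u, hu⟩ := isUnit_twistX a
    obtain ⟨X, hXu⟩ := isUnit_stdX a
    have hu' : ∀ i, (u : S.Op) * S.digitProj a i = S.digitProj a (i + 1) * u := by
      rw [hu]; exact twistX_mul_digitProj a
    have hX' : ∀ i, (X : S.Op) * S.digitProj a i = S.digitProj a (i + 1) * X := by
      rw [hXu]; exact stdX_mul_digitProj a
    have hmem : ∀ b ∈ ({a} : Set S.Dof), b ∈ ((insert a N : Finset S.Dof) : Set S.Dof) := by
      rintro b rfl; simp
    rw [← sum_clockShiftComponent (digitProj_mul a) (sum_digitProj a) hu' hX' M]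
    refine sum_mem fun k _ => sum_mem fun l _ => mul_mem ?_ (mul_mem ?_ ?_)
    · refine dofAlgebra_mono (N := (N : Set S.Dof)) (by simp) (ih (fun c hc i => ?_) fun c hc => ?_)
      · by_cases hca : c = a
        · subst hca
          exact commute_projection_clockShiftComponent (digitProj_mul c) hu' M _ l i
        · have hc' : c ∉ insert a N := by simp [hca, hc]
          refine commute_clockShiftComponent (fun j => digitProj_commute c a i j) ?_ (Or.inl ?_)
            (hp c hc' i) _ l
          · rw [hXu]; exact digitProj_commute_stdX hca i
          · rw [hu]; exact digitProj_commute_twistX hca i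
      · by_cases hca : c = a
        · subst hca
          rw [← hu]
          refine commute_unit_clockShiftComponent (fun A => ?_) M _ l
          rw [Units.val_pow_eq_pow_val, hu]
          exact twistX_pow_commute c A
        · have hc' : c ∉ insert a N := by simp [hca, hc]
          have hca' : c ∉ ({a} : Set S.Dof) := hca
          have h1 : ∀ j, Commute (S.twistX c) (S.digitProj a j) := fun j =>
            twistX_commute_of_mem hca' (digitProj_mem (Set.mem_singleton a) j)
          have h2 : Commute (S.twistX c) X := by
            rw [hXu]; exact twistX_commute_of_mem hca' (stdX_mem (Set.mem_singleton a))
          have h3 : S.twistX c * u = u * S.twistX c ∨ S.twistX c * u = -(u * S.twistX c) := by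
            rw [hu]; exact twistX_mul_twistX hca
          exact commute_clockShiftComponent h1 h2 h3 (hX c hc') _ l
    · exact digitProj_mem (hmem a rfl) l
    · rw [Units.val_pow_eq_pow_val, hXu]
      exact pow_mem (stdX_mem (hmem a rfl)) _

/-- Operators commuting with the separator and the twisted flipper of every degree of freedom
outside `N` belong to the algebra generated by `N`. -/
theorem mem_dofAlgebra_of_commute {N : Set S.Dof} {M : S.Op}
    (hZ : ∀ a ∉ N, ∀ x y, M x y ≠ 0 → S.digit a x = S.digit a y)
    (hX : ∀ a ∉ N, Commute (S.twistX a) M) : M ∈ S.dofAlgebra N := by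
  have h := mem_dofAlgebra_of_commute_digitProj N.toFinite.toFinset (M := M)
    (fun a ha i => ?_) fun a ha => hX a (by simpa using ha)
  · simpa using h
  · refine ((mul_diagonal_eq_iff M _ _).2 fun x y => ?_).symm
    by_cases hM : M x y = 0
    · simp [hM]
    · rw [hZ a (by simpa using ha) x y hM, mul_comm]

end QuantumSystem

/-! ### The joint eigenbasis generated by the flippers. -/

namespace QuantumSystem

variable {Site : Type*} {S : QuantumSystem Site}

theorem exists_first_digit {y : S.Basis} (h : ∃ b, S.digit b y ≠ 0) :
    ∃ p : S.Dof × S.Basis, S.shift p.1 p.2 = y ∧ S.digit p.1 y = S.digit p.1 p.2 + 1 ∧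
      ∀ e, S.rank e < S.rank p.1 → S.digit e y = 0 := by
  obtain ⟨b, hby, hmin⟩ :=
    (Set.toFinite {b | S.digit b y ≠ 0}).exists_minimalFor S.rank _ h
  obtain ⟨x, hx, hd, -⟩ := exists_shift_eq hby
  refine ⟨(b, x), hx, hd, fun e he => ?_⟩
  by_contra hne
  exact absurd (hmin hne he.le) (not_le.2 he)

open Classical in
/-- The vectors obtained from `v` by applying powers of the flippers in the order of `rank`. -/
noncomputable def orbit (X : S.Dof → S.Op) (v : S.Basis → ℂ) (y : S.Basis) : S.Basis → ℂ :=
  if h : ∃ b, S.digit b y ≠ 0 then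
    (X (exists_first_digit h).choose.1).mulVec (orbit X v (exists_first_digit h).choose.2)
  else v
termination_by ∑ b, S.digit b y
decreasing_by
  exact sum_digit_lt (exists_first_digit h).choose_spec.1 (exists_first_digit h).choose_spec.2.1

/-- With all labels below `a` zero and no wrap-around, `a` is the label that the recursion removes
from the shifted state. Hence no phase appears; this is the source of the axial gauge. -/
theorem orbit_shift (X : S.Dof → S.Op) (v : S.Basis → ℂ) {a : S.Dof} {x : S.Basis}
    (h0 : ∀ b, S.rank b < S.rank a → S.digit b x = 0) (hx : S.digit a x + 1 < S.dofDim a) :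
    orbit X v (S.shift a x) = (X a).mulVec (orbit X v x) := by
  have hda : S.digit a (S.shift a x) ≠ 0 := by rw [digit_shift_of_lt hx]; omega
  have h : ∃ b, S.digit b (S.shift a x) ≠ 0 := ⟨a, hda⟩
  rw [orbit, dif_pos h]
  obtain ⟨hs, hd, hmin⟩ := (exists_first_digit h).choose_spec
  set p := (exists_first_digit h).choose
  have hp : p.1 = a := by
    refine rank_injective ?_
    rcases lt_trichotomy (S.rank p.1) (S.rank a) with hlt | heq | hgt
    · have hne : p.1 ≠ a := fun e => by rw [e] at hlt; exact lt_irrefl _ hlt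
      rw [digit_shift_of_ne hne, h0 _ hlt] at hd
      omega
    · exact heq
    · exact absurd (hmin a hgt) hda
  rw [hp] at hs ⊢
  rw [(shift_bijective a).1 hs]

theorem orbit_induction {X : S.Dof → S.Op} {v : S.Basis → ℂ}
    {motive : S.Basis → (S.Basis → ℂ) → Prop} (h0 : motive S.vacuum v)
    (hs : ∀ a x w, motive x w → motive (S.shift a x) ((X a).mulVec w)) (y : S.Basis) :
    motive y (orbit X v y) := by
  have key : ∀ n : ℕ, ∀ y : S.Basis, ∑ b, S.digit b y = n → motive y (orbit X v y) := by
    intro n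
    induction n using Nat.strong_induction_on with
    | _ n ih =>
      intro y hn
      rw [orbit]
      split_ifs with h
      · obtain ⟨hsh, hd, -⟩ := (exists_first_digit h).choose_spec
        have := hs (exists_first_digit h).choose.1 _ _
          (ih _ (by have := sum_digit_lt hsh hd; omega) (exists_first_digit h).choose.2 rfl)
        rwa [hsh] at this
      · push Not at h
        rwa [show y = S.vacuum from basis_ext fun a => by rw [h a, digit_vacuum]]
  exact key _ y rfl

theorem exists_joint_eigenvector {n : Type*} [Fintype n] [DecidableEq n] {ι : Type*}
    {Z : ι → Matrix n n ℂ} {ω : ι → ℂ}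
    (h : Module.finrank ℂ (⨅ a, Module.End.eigenspace (Matrix.toLin' (Z a)) (ω a) :
      Submodule ℂ (n → ℂ)) = 1) :
    ∃ v : n → ℂ, star v ⬝ᵥ v = 1 ∧ ∀ a, (Z a).mulVec v = ω a • v := by
  obtain ⟨w, hw, hw0⟩ := Submodule.exists_mem_ne_zero_of_ne_bot
    (fun e => by rw [e, finrank_bot] at h; exact zero_ne_one h : (⨅ a, Module.End.eigenspace
      (Matrix.toLin' (Z a)) (ω a) : Submodule ℂ (n → ℂ)) ≠ ⊥)
  have hr : star w ⬝ᵥ w = ((∑ i, Complex.normSq (w i) : ℝ) : ℂ) := by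
    simp only [dotProduct, Pi.star_apply, Complex.ofReal_sum, Complex.normSq_eq_conj_mul_self]
    rfl
  set r := ∑ i, Complex.normSq (w i)
  have hr0 : r ≠ 0 := by
    intro e
    rw [e, Complex.ofReal_zero] at hr
    refine hw0 (funext fun i => ?_)
    have hsum := (Finset.sum_eq_zero_iff_of_nonneg fun i _ => Complex.normSq_nonneg (w i)).1 e i
      (Finset.mem_univ i)
    exact Complex.normSq_eq_zero.1 hsum
  have hrpos : 0 ≤ r := Finset.sum_nonneg fun i _ => Complex.normSq_nonneg _
  refine ⟨((Real.sqrt r)⁻¹ : ℂ) • w, ?_, fun a => ?_⟩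
  · rw [star_smul, smul_dotProduct, dotProduct_smul, hr]
    simp only [smul_eq_mul, Complex.star_def, map_inv₀, Complex.conj_ofReal]
    rw [← mul_assoc, ← mul_inv, ← Complex.ofReal_mul, Real.mul_self_sqrt hrpos]
    exact inv_mul_cancel₀ (Complex.ofReal_ne_zero.2 hr0)
  · have := Module.End.mem_eigenspace_iff.1 ((Submodule.mem_iInf _).1 hw a)
    rw [Matrix.toLin'_apply] at this
    rw [Matrix.mulVec_smul, this, smul_comm]

theorem dotProduct_mulVec_of_mem_unitary {n : Type*} [Fintype n] [DecidableEq n]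
    {X : Matrix n n ℂ} (hX : X ∈ unitary (Matrix n n ℂ)) (v w : n → ℂ) :
    star (X.mulVec v) ⬝ᵥ X.mulVec w = star v ⬝ᵥ w := by
  rw [Matrix.star_mulVec, ← Matrix.dotProduct_mulVec, Matrix.mulVec_mulVec]
  have : X.conjTranspose * X = 1 := (Unitary.mem_iff.1 hX).1
  rw [this, Matrix.one_mulVec]

theorem dotProduct_eq_zero_of_eigenvalue_ne {n : Type*} [Fintype n] [DecidableEq n]
    {Z : Matrix n n ℂ} (hZ : Z ∈ unitary (Matrix n n ℂ)) {v w : n → ℂ} {a b : ℂ}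
    (ha : star a * a = 1) (hv : Z.mulVec v = a • v) (hw : Z.mulVec w = b • w) (hab : a ≠ b) :
    star v ⬝ᵥ w = 0 := by
  have h := dotProduct_mulVec_of_mem_unitary hZ v w
  rw [hv, hw, star_smul, smul_dotProduct, dotProduct_smul, smul_smul, smul_eq_mul] at h
  by_contra h0
  have h1 : star a * b = 1 := mul_right_cancel₀ h0 (by rw [h, one_mul])
  have ha0 : star a ≠ 0 := left_ne_zero_of_mul_eq_one ha
  exact hab (mul_left_cancel₀ ha0 (by rw [ha, h1]))

theorem star_mul_self_of_pow_eq_one {z : ℂ} {n : ℕ} (hn : n ≠ 0) (h : z ^ n = 1) :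
    star z * z = 1 := by
  rw [Complex.star_def, ← Complex.normSq_eq_conj_mul_self, Complex.normSq_eq_norm_sq,
    Complex.norm_eq_one_of_pow_eq_one h hn]
  simp

theorem clock_pow_star_mul_self (a : S.Dof) (k : ℕ) :
    star (S.clock a ^ k) * S.clock a ^ k = 1 :=
  star_mul_self_of_pow_eq_one (NeZero.ne (S.dofDim a))
    (by rw [pow_right_comm, (clock_isPrimitiveRoot a).pow_eq_one, one_pow])

variable [MetricSpace Site]

/-- A separator is simultaneously diagonalized by a unitary which turns the flippers into
shifts with phases in axial gauge. -/
theorem exists_unitary_diagonalizing {R : ℝ} {Z X : S.Dof → S.Op}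
    (hZ : S.IsSeparator R S.dofDim (fun a => a.isRight) Z)
    (hX : S.IsLocalFlipper R S.dofDim (fun a => a.isRight) Z X) :
    ∃ (U : unitary S.Op) (t : S.Dof → S.Basis → ℂ),
      (∀ a, Z a * U = U * S.stdZ a) ∧
      (∀ a, X a * U = U * S.monomial (S.shift a) (t a)) ∧
      (∀ a y, t a y ≠ 0) ∧
      ∀ a y, (∀ b, S.rank b < S.rank a → S.digit b y = 0) →
        S.digit a y + 1 < S.dofDim a → t a y = 1 := by
  obtain ⟨v, hv1, hv⟩ := exists_joint_eigenvector (hZ.one_dimensional (fun _ => 1)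
    fun a => one_pow _)
  have hP : ∀ y, star (orbit X v y) ⬝ᵥ orbit X v y = 1 ∧
      ∀ a, (Z a).mulVec (orbit X v y) = S.clock a ^ S.digit a y • orbit X v y := by
    refine orbit_induction (motive := fun y w => star w ⬝ᵥ w = 1 ∧
      ∀ a, (Z a).mulVec w = S.clock a ^ S.digit a y • w) ⟨hv1, fun a => ?_⟩ ?_
    · rw [hv, digit_vacuum, pow_zero]
    · rintro a x w ⟨hw1, hw⟩
      refine ⟨by rw [dotProduct_mulVec_of_mem_unitary (hX.unitary a), hw1], fun b => ?_⟩
      by_cases hba : b = a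
      · subst hba
        have hf : Z b * X b = S.clock b • (X b * Z b) := hX.flip b
        rw [Matrix.mulVec_mulVec, hf, Matrix.smul_mulVec, ← Matrix.mulVec_mulVec, hw,
          Matrix.mulVec_smul, smul_smul, clock_pow_digit_shift]
      · rw [Matrix.mulVec_mulVec, hX.commute a b hba, ← Matrix.mulVec_mulVec, hw,
          Matrix.mulVec_smul, digit_shift_of_ne hba]
  set P := orbit X v with hPdef
  have hP0 : ∀ y, P y ≠ 0 := by
    intro y e
    have := (hP y).1
    rw [e] at this
    simp at this
  let U : S.Op := Matrix.of fun x y => P y x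
  have hU : star U * U = 1 := by
    ext y z
    have : (star U * U) y z = star (P y) ⬝ᵥ P z := rfl
    rw [this]
    by_cases hyz : y = z
    · subst hyz; rw [(hP y).1, Matrix.one_apply_eq]
    · rw [Matrix.one_apply_ne hyz]
      obtain ⟨a, ha⟩ : ∃ a, S.digit a y ≠ S.digit a z := by
        by_contra h
        push Not at h
        exact hyz (basis_ext h)
      exact dotProduct_eq_zero_of_eigenvalue_ne (hZ.unitary a) (clock_pow_star_mul_self a _)
        ((hP y).2 a) ((hP z).2 a) fun e => ha (clock_pow_digit_injective e)
  -- A one-sided inverse suffices: the eigenbasis is indexed by `S.Basis`, so `U` is square.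
  have hUu : U ∈ unitary S.Op := Unitary.mem_iff.2 ⟨hU, mul_eq_one_comm.1 hU⟩
  -- The flipper sends the vector at `y` into the joint eigenspace with the shifted labels, which is
  -- a line.
  have ht : ∀ a y, ∃ t : ℂ, t • P (S.shift a y) = (X a).mulVec (P y) := by
    intro a y
    have hone := hZ.one_dimensional (fun b => S.clock b ^ S.digit b (S.shift a y))
      fun b => by rw [pow_right_comm, (clock_isPrimitiveRoot b).pow_eq_one, one_pow]
    have hmem : ∀ w : S.Basis → ℂ,
        (∀ b, (Z b).mulVec w = S.clock b ^ S.digit b (S.shift a y) • w) →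
        w ∈ (⨅ b, Module.End.eigenspace (Matrix.toLin' (Z b))
          (S.clock b ^ S.digit b (S.shift a y)) : Submodule ℂ (S.Basis → ℂ)) := fun w hw =>
      (Submodule.mem_iInf _).2 fun b => Module.End.mem_eigenspace_iff.2 (hw b)
    obtain ⟨t, ht⟩ := (finrank_eq_one_iff_of_nonzero' (⟨_, hmem _ (hP (S.shift a y)).2⟩ :
      (⨅ b, Module.End.eigenspace (Matrix.toLin' (Z b))
          (S.clock b ^ S.digit b (S.shift a y)) : Submodule ℂ (S.Basis → ℂ)))
      (fun e => hP0 _ (congrArg Subtype.val e))).1 hone ⟨(X a).mulVec (P y), hmem _ fun b => by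
        by_cases hba : b = a
        · subst hba
          have hf : Z b * X b = S.clock b • (X b * Z b) := hX.flip b
          rw [Matrix.mulVec_mulVec, hf, Matrix.smul_mulVec, ← Matrix.mulVec_mulVec, (hP y).2,
            Matrix.mulVec_smul, smul_smul, clock_pow_digit_shift]
        · rw [Matrix.mulVec_mulVec, hX.commute a b hba, ← Matrix.mulVec_mulVec, (hP y).2,
            Matrix.mulVec_smul, digit_shift_of_ne hba]⟩
    exact ⟨t, congrArg Subtype.val ht⟩
  choose t ht using ht
  refine ⟨⟨U, hUu⟩, t, fun a => ?_, fun a => ?_, fun a y e => ?_, fun a y h0 h1 => ?_⟩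
  · ext x y
    have h : (Z a * U) x y = (Z a).mulVec (P y) x := rfl
    change (Z a * U) x y = (U * S.stdZ a) x y
    rw [h, (hP y).2, stdZ, Matrix.mul_diagonal, mul_comm]
    rfl
  · ext x y
    have h : (X a * U) x y = (X a).mulVec (P y) x := rfl
    change (X a * U) x y = (U * S.monomial (S.shift a) (t a)) x y
    rw [h, ← ht, mul_monomial_apply, mul_comm]
    rfl
  · have h := ht a y
    rw [e, zero_smul] at h
    have := dotProduct_mulVec_of_mem_unitary (hX.unitary a) (P y) (P y)
    rw [← h, (hP y).1] at this
    simp at this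
  · have h := ht a y
    rw [hPdef, ← orbit_shift X v h0 h1] at h
    have h' : (t a y - 1) • P (S.shift a y) = 0 := by rw [sub_smul, one_smul, hPdef, h, sub_self]
    exact sub_eq_zero.1 ((smul_eq_zero.1 h').resolve_right (hP0 _))

end QuantumSystem

/-! ### Supports of flippers and locality of the diagonalizing automorphism. -/

namespace QuantumSystem

variable {Site : Type*} {S : QuantumSystem Site}

instance basis_nonempty : Nonempty S.Basis := ⟨S.vacuum⟩

theorem disjoint_dofSite {Ω Ω' : Set Site} (h : Disjoint Ω Ω') :
    Disjoint (S.dofSite ⁻¹' Ω) (S.dofSite ⁻¹' Ω') := h.preimage _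

theorem monomial_injective_phase {σ : S.Basis → S.Basis} {s t : S.Basis → ℂ}
    (h : S.monomial σ s = S.monomial σ t) : s = t := by
  funext y
  have := congrFun (congrFun h (σ y)) y
  simpa [monomial_apply] using this

/-- The phase of the twisted standard flipper. -/
def twist (S : QuantumSystem Site) : S.Dof → S.Basis → ℂ
  | Sum.inl _, _ => 1
  | Sum.inr _, y => S.parityPhase y

theorem twistX_eq (a : S.Dof) :
    S.twistX a = S.monomial (S.shift a) fun y => S.phase a y * S.twist a y := by
  rcases a with q | j
  · simp [twistX, stdX, twist]
  · rw [twistX, stdX, parityOp_eq, monomial_mul_diagonal]; rfl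

/-- An operator which commutes with the separator and has the same commutation signs as the
parity operator with flippers is a multiple of the parity operator. -/
theorem eq_smul_parityOp {M : S.Op} {t : S.Dof → S.Basis → ℂ} (ht : ∀ a y, t a y ≠ 0)
    (hZ : ∀ a, M * S.stdZ a = S.stdZ a * M)
    (hq : ∀ q, M * S.monomial (S.shift (Sum.inl q)) (t (Sum.inl q)) =
      S.monomial (S.shift (Sum.inl q)) (t (Sum.inl q)) * M)
    (hf : ∀ j, M * S.monomial (S.shift (Sum.inr j)) (t (Sum.inr j)) =
      -(S.monomial (S.shift (Sum.inr j)) (t (Sum.inr j)) * M)) :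
    ∃ c : ℂ, M = c • S.parityOp := by
  have hdiag : ∀ x y, x ≠ y → M x y = 0 := by
    intro x y hxy
    by_contra hM
    refine hxy (basis_ext fun a => clock_pow_digit_injective ?_)
    have := (mul_diagonal_eq_iff M _ _).1 (hZ a) x y
    rw [mul_comm] at this
    exact (mul_right_cancel₀ hM this).symm
  have hshift : ∀ a ∈ (Set.univ : Set S.Dof), ∀ y, M (S.shift a y) (S.shift a y) /
      S.parityPhase (S.shift a y) = M y y / S.parityPhase y := by
    rintro (q | j) - y
    · have := (mul_monomial_eq_iff (shift_bijective _) M _ _).1 (hq q) y y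
      rw [parityPhase_shift_inl]
      rw [mul_comm] at this
      rw [mul_left_cancel₀ (ht _ y) this]
    · have h := hf j
      rw [← neg_mul, ← neg_one_smul ℂ, smul_monomial] at h
      have := (mul_monomial_eq_iff (shift_bijective _) M _ _).1 h y y
      have hM : M (S.shift (Sum.inr j) y) (S.shift (Sum.inr j) y) = -M y y :=
        mul_right_cancel₀ (ht _ y) (by rw [this]; ring)
      rw [parityPhase_shift_inr, hM, neg_div_neg_eq]
  refine ⟨M S.vacuum S.vacuum / S.parityPhase S.vacuum, ?_⟩
  ext x y
  by_cases hxy : x = y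
  · subst hxy
    have := eq_of_shift_invariant (F := fun y => M y y / S.parityPhase y) hshift x S.vacuum
      fun a ha => absurd (Set.mem_univ a) ha
    rw [← this, parityOp_eq, Matrix.smul_apply, Matrix.diagonal_apply_eq, smul_eq_mul,
      div_mul_cancel₀ _ (parityPhase_ne_zero x)]
  · rw [hdiag x y hxy, parityOp_eq, Matrix.smul_apply, Matrix.diagonal_apply_ne _ hxy, smul_zero]

variable [MetricSpace Site]

section Supports

variable {ι : Type*} {R : ℝ} {D : ι → ℕ} {fermionic : ι → Prop} {Z X : ι → S.Op}

/-- The flip relation has a phase different from one and the product is invertible. The supports of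
an element and its flipper must therefore meet. -/
theorem IsLocalFlipper.not_commute (hZ : S.IsSeparator R D fermionic Z)
    (hX : S.IsLocalFlipper R D fermionic Z X) (a : ι) : ¬ Commute (X a) (Z a) := by
  intro h
  have hf := hX.flip a
  rw [← h.eq] at hf
  have h0 : (Complex.exp (2 * Real.pi * Complex.I / (D a : ℂ)) - 1) • (X a * Z a) = 0 := by
    rw [sub_smul, one_smul, ← hf, sub_self]
  have hprim := Complex.isPrimitiveRoot_exp (D a) (by have := hZ.two_le a; omega)
  rcases smul_eq_zero.1 h0 with h1 | h1
  · exact hprim.ne_one (by have := hZ.two_le a; omega) (sub_eq_zero.1 h1)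
  · have hu : X a * Z a ∈ _root_.unitary S.Op := mul_mem (hX.unitary a) (hZ.unitary a)
    rw [h1, Unitary.mem_iff] at hu
    simp at hu

/-- A disk supporting an element of a separator is close to the center of its flipper. -/
theorem IsLocalFlipper.supportingDisk_subset (hZ : S.IsSeparator R D fermionic Z)
    (hX : S.IsLocalFlipper R D fermionic Z X) {a : ι} {Ω : Set Site} {c : Site}
    (hΩ : S.IsSupportingDisk R (Z a) Ω) (hc : S.SupportedOn (Metric.closedBall c R) (X a)) :
    Ω ⊆ Metric.closedBall c (2 * R) := by
  have hnd : ¬ Disjoint (Metric.closedBall c R) Ω := fun h =>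
    hX.not_commute hZ a (commute_of_isEven (disjoint_dofSite h) hc hΩ.2 (hZ.even a))
  obtain ⟨s, hs, hsΩ⟩ := Set.not_disjoint_iff.1 hnd
  intro t ht
  have h1 := hΩ.1 t ht s hsΩ
  have h2 := Metric.mem_closedBall.1 hs
  exact Metric.mem_closedBall.2 (by linarith [dist_triangle t s c])

theorem IsLocalFlipper.separator_mem (hZ : S.IsSeparator R D fermionic Z)
    (hX : S.IsLocalFlipper R D fermionic Z X) {a : ι} {c : Site}
    (hc : S.SupportedOn (Metric.closedBall c R) (X a)) :
    Z a ∈ S.dofAlgebra (S.dofSite ⁻¹' Metric.closedBall c (2 * R)) := by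
  obtain ⟨Ω, hΩ⟩ := hZ.local_support a
  exact dofAlgebra_mono (Set.preimage_mono (hX.supportingDisk_subset hZ hΩ hc)) hΩ.2

/-- A negative radius would make the ball of the flipper empty, hence disjoint from the support of
the element. -/
theorem IsLocalFlipper.radius_nonneg (hZ : S.IsSeparator R D fermionic Z)
    (hX : S.IsLocalFlipper R D fermionic Z X) (a : ι) : 0 ≤ R := by
  obtain ⟨Ω, hΩ⟩ := hZ.local_support a
  obtain ⟨c, hc⟩ := hX.local_support a
  by_contra hR
  have hnd : Disjoint (Metric.closedBall c R) Ω := by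
    rw [Metric.closedBall_eq_empty.2 (not_le.1 hR)]
    exact Set.empty_disjoint _
  exact hX.not_commute hZ a (commute_of_isEven (disjoint_dofSite hnd) hc hΩ.2 (hZ.even a))

end Supports

theorem parity_flipper {R : ℝ} {Z X : S.Dof → S.Op}
    (hX : S.IsLocalFlipper R S.dofDim (fun a => a.isRight) Z X) :
    (∀ q, S.IsEven (X (Sum.inl q))) ∧ ∀ j, S.IsOdd (X (Sum.inr j)) :=
  ⟨fun q => hX.even _ (by simp), fun j => hX.odd _ rfl⟩

theorem flipper_exchange {R : ℝ} {Z X : S.Dof → S.Op}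
    (hX : S.IsLocalFlipper R S.dofDim (fun a => a.isRight) Z X) {c : S.Dof → Site}
    (hc : ∀ a, S.SupportedOn (Metric.closedBall (c a) R) (X a)) {a b : S.Dof}
    (hab : 2 * R < dist (c a) (c b)) :
    X a * X b = S.exchangeSign a b • (X b * X a) := by
  have hd : Disjoint (S.dofSite ⁻¹' Metric.closedBall (c a) R)
      (S.dofSite ⁻¹' Metric.closedBall (c b) R) :=
    disjoint_dofSite (Metric.closedBall_disjoint_closedBall (by linarith))
  obtain ⟨he, ho⟩ := parity_flipper hX
  rcases b with r | k
  · have : S.exchangeSign a (Sum.inl r) = 1 := by rcases a with q | j <;> rfl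
    rw [this, one_smul]
    exact commute_of_isEven hd (hc _) (hc _) (he r)
  rcases a with q | j
  · rw [exchangeSign, one_smul]
    · exact (commute_of_isEven hd.symm (hc _) (hc _) (he q)).symm
    · simp
  · rw [exchangeSign, neg_smul, one_smul]
    exact anticommute_of_isOdd hd (hc _) (hc _) (ho j) (ho k)

/-- A locally flippable separator whose elements are labelled by the degrees of freedom is mapped
to the standard separator by a locality preserving automorphism. -/
theorem exists_automorphism {R : ℝ} {Z X : S.Dof → S.Op}
    (hZ : S.IsSeparator R S.dofDim (fun a => a.isRight) Z)
    (hX : S.IsLocalFlipper R S.dofDim (fun a => a.isRight) Z X) {c : S.Dof → Site}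
    (hc : ∀ a, S.SupportedOn (Metric.closedBall (c a) R) (X a)) :
    ∃ α : S.Op ≃⋆ₐ[ℂ] S.Op, (∀ O, S.IsEven O → S.IsEven (α O)) ∧
      (∀ O, S.IsOdd O → S.IsOdd (α O)) ∧ (∀ a, α (Z a) = S.stdZ a) ∧
      ∀ i O, S.SupportedOn {i} O → α O ∈ S.dofAlgebra {a | dist (c a) i ≤ 6 * R} := by
  obtain ⟨U, t, hUZ, hUX, ht, hgauge⟩ := exists_unitary_diagonalizing hZ hX
  let α : S.Op ≃⋆ₐ[ℂ] S.Op := Unitary.conjStarAlgAut ℂ S.Op (star U)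
  have hα : ∀ {O T : S.Op}, O * U = U * T → α O = T := by
    intro O T h
    have : α O = star (U : S.Op) * O * U := Unitary.conjStarAlgAut_star_apply U O
    rw [this, mul_assoc, h, ← mul_assoc, Unitary.coe_star_mul_self, one_mul]
  have hαZ : ∀ a, α (Z a) = S.stdZ a := fun a => hα (hUZ a)
  have hαX : ∀ a, α (X a) = S.monomial (S.shift a) (t a) := fun a => hα (hUX a)
  obtain ⟨hXe, hXo⟩ := parity_flipper hX
  -- The image of the parity operator keeps its commutation signs with the images of elements and
  -- flippers, which determine it up to a scalar. Preservation of even and odd operators follows.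
  obtain ⟨p, hp⟩ : ∃ p : ℂ, α S.parityOp = p • S.parityOp := by
    refine eq_smul_parityOp ht (fun a => ?_) (fun q => ?_) fun j => ?_
    · rw [← hαZ, ← map_mul, ← map_mul, show S.parityOp * Z a = Z a * S.parityOp from hZ.even a]
    · rw [← hαX, ← map_mul, ← map_mul,
        show S.parityOp * X (Sum.inl q) = X (Sum.inl q) * S.parityOp from hXe q]
    · rw [← hαX, ← map_mul, ← map_mul, ← map_neg,
        show S.parityOp * X (Sum.inr j) = -(X (Sum.inr j) * S.parityOp) from hXo j]
  have hp0 : p ≠ 0 := by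
    rintro rfl
    rw [zero_smul] at hp
    have := (isUnit_parityOp (S := S)).map α
    rw [hp] at this
    exact not_isUnit_zero this
  have hflat : ∀ a b, 2 * R < dist (c a) (c b) → a ≠ b → ∀ y,
      t a (S.shift b y) * t b y = S.exchangeSign a b * (t b (S.shift a y) * t a y) := by
    intro a b hab hne y
    have h := congrArg α (flipper_exchange hX hc hab)
    rw [map_mul, map_smul, map_mul, hαX, hαX, monomial_mul, monomial_mul, smul_monomial] at h
    have hσ : S.shift b ∘ S.shift a = S.shift a ∘ S.shift b := funext fun y => shift_comm b a y
    rw [hσ] at h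
    exact congrFun (monomial_injective_phase h) y
  -- Beyond `4 * R` every `b` is more than `2 * R` from `c a` or from `c d`, so its flipper is
  -- disjoint from that of `a` or of `d`.
  have hinv : ∀ a d, 4 * R < dist (c a) (c d) → ∀ y,
      t a (S.shift d y) / S.phase a (S.shift d y) = t a y / S.phase a y := by
    intro a d had y
    have hR : 0 ≤ R := hX.radius_nonneg hZ a
    refine phase_shift_invariant (u := fun a y => t a y / S.phase a y)
      (far := fun a b => 2 * R < dist (c a) (c b)) (fun a y => div_ne_zero (ht a y)
        (phase_ne_zero a y)) (fun a b h => by rwa [dist_comm]) (fun a y h0 h1 => ?_)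
        (fun a b hab y => ?_) (by linarith) ?_ (fun b => ?_) y
    · rw [hgauge a y h0 h1, phase_eq_one h0, div_one]
    · have hne : a ≠ b := by
        rintro rfl
        rw [dist_self] at hab
        linarith
      rw [div_mul_div_comm, div_mul_div_comm, hflat a b hab hne, phase_exchange hne]
      refine mul_div_mul_left _ _ ?_
      rcases a with q | j <;> rcases b with r | k <;> simp [exchangeSign]
    · rintro rfl
      rw [dist_self] at had
      linarith
    · by_contra h
      push Not at h
      have := dist_triangle (c a) (c b) (c d)
      rw [dist_comm (c a) (c b)] at this
      linarith [h.1, h.2]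
  refine ⟨α, fun O hO => ?_, fun O hO => ?_, hαZ, fun i O hO => ?_⟩
  · have h := congrArg α (show S.parityOp * O = O * S.parityOp from hO)
    rw [map_mul, map_mul, hp, smul_mul_assoc, mul_smul_comm] at h
    exact smul_right_injective _ hp0 h
  · have h := congrArg α (show S.parityOp * O = -(O * S.parityOp) from hO)
    rw [map_mul, map_neg, map_mul, hp, smul_mul_assoc, mul_smul_comm, ← smul_neg] at h
    exact smul_right_injective _ hp0 h
  · have hdisj : ∀ a r, r < dist (c a) i → Disjoint (S.dofSite ⁻¹' {i})
        (S.dofSite ⁻¹' Metric.closedBall (c a) r) := by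
      intro a r h
      refine disjoint_dofSite (Set.disjoint_singleton_left.2 fun hi => ?_)
      rw [Metric.mem_closedBall, dist_comm] at hi
      linarith
    -- The element `Z a` is supported within `2 * R` of the center of its flipper.
    have hdig : ∀ a, 2 * R < dist (c a) i → ∀ x y, α O x y ≠ 0 → S.digit a x = S.digit a y := by
      intro a ha x y hxy
      have hcomm : Commute O (Z a) :=
        commute_of_isEven (hdisj a _ ha) hO (hX.separator_mem hZ (hc a)) (hZ.even a)
      have h := congrArg α hcomm.eq
      rw [map_mul, map_mul, hαZ] at h
      have := (mul_diagonal_eq_iff _ _ _).1 h x y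
      rw [mul_comm] at this
      exact (clock_pow_digit_injective (mul_right_cancel₀ hxy this)).symm
    refine mem_dofAlgebra_of_commute (fun a ha => hdig a ?_) fun a ha => ?_
    · have hR : 0 ≤ R := hX.radius_nonneg hZ a
      have := not_le.1 (show ¬ dist (c a) i ≤ 6 * R from ha)
      linarith
    · have hR : 0 ≤ R := hX.radius_nonneg hZ a
      have hai : 6 * R < dist (c a) i := not_le.1 ha
      -- Commutation with the image of the flipper, twisted by parity if odd, still with the phases
      -- `t a`. It remains to trade these for the standard phases.
      have hcomm : α O * S.monomial (S.shift a) (fun y => t a y * S.twist a y) =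
          S.monomial (S.shift a) (fun y => t a y * S.twist a y) * α O := by
        rcases a with q | j
        · have hO' : Commute O (X (Sum.inl q)) :=
            commute_of_isEven (hdisj _ R (by linarith)) hO (hc _) (hXe q)
          have h := congrArg α hO'.eq
          rw [map_mul, map_mul, hαX] at h
          simpa [twist] using h
        · have hO' : Commute O (X (Sum.inr j) * S.parityOp) :=
            commute_mul_parityOp (hdisj _ R (by linarith)) hO (hc _) (hXo j)
          have hXP : α (X (Sum.inr j) * S.parityOp) =
              p • (S.monomial (S.shift (Sum.inr j)) (t (Sum.inr j)) * S.parityOp) := by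
            rw [map_mul, hp, hαX, mul_smul_comm]
          have h := congrArg α hO'.eq
          rw [map_mul α O, map_mul α (X (Sum.inr j) * S.parityOp), hXP, mul_smul_comm,
            smul_mul_assoc] at h
          have h' := smul_right_injective S.Op hp0 h
          rwa [parityOp_eq, monomial_mul_diagonal] at h'
      rw [twistX_eq]
      refine ((mul_monomial_eq_iff (shift_bijective a) _ _ _).2 fun x y => ?_).symm
      have h := (mul_monomial_eq_iff (shift_bijective a) _ _ _).1 hcomm x y
      by_cases hM : α O x y = 0
      · rw [hM, mul_zero] at h ⊢
        have htw : t a y * S.twist a y ≠ 0 := by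
          refine mul_ne_zero (ht a y) ?_
          rcases a with q | j
          · exact one_ne_zero
          · exact parityPhase_ne_zero y
        rw [(mul_eq_zero.1 h).resolve_right htw, zero_mul]
      -- A nonzero entry joins states that differ only in labels centered within `2 * R` of `i`. As
      -- `c a` is more than `6 * R` from `i`, those labels are more than `4 * R` from `c a` and do
      -- not affect the ratio.
      · have hu : t a x / S.phase a x = t a y / S.phase a y := by
          refine eq_of_shift_invariant (N := {d | dist (c d) i ≤ 2 * R})
            (F := fun y => t a y / S.phase a y) (fun d hd y => hinv a d ?_ y) x y
            fun d hd => hdig d (not_le.1 hd) x y hM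
          have hd' : dist (c d) i ≤ 2 * R := hd
          linarith [dist_triangle (c a) (c d) i]
        have hx : t a x = t a y / S.phase a y * S.phase a x := by
          rw [← hu, div_mul_cancel₀ _ (phase_ne_zero a x)]
        rw [hx] at h
        have hq : t a y / S.phase a y ≠ 0 := div_ne_zero (ht a y) (phase_ne_zero a y)
        refine mul_left_cancel₀ hq ?_
        calc _ = α O (S.shift a x) (S.shift a y) *
              (t a y / S.phase a y * S.phase a y * S.twist a y) := by ring
          _ = _ := by rw [div_mul_cancel₀ _ (phase_ne_zero a y), h]; ring

end QuantumSystem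

/-! ### The standard separator, and relabelling by degrees of freedom. -/

namespace QuantumSystem

variable {Site : Type*} {S : QuantumSystem Site}

theorem exists_basis_digit {k : S.Dof → ℕ} (hk : ∀ a, k a < S.dofDim a) :
    ∃ y : S.Basis, ∀ a, S.digit a y = k a := by
  refine ⟨(fun q => ⟨k (Sum.inl q), hk _⟩, fun j => decide (k (Sum.inr j) = 1)), ?_⟩
  rintro (q | j)
  · rfl
  · have : k (Sum.inr j) < 2 := hk (Sum.inr j)
    simp only [digit]
    interval_cases k (Sum.inr j) <;> rfl

/-- The eigenvalues determine every label, hence a single basis state. Needed because a trivial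
separator is required to be a separator, of diameter zero. -/
theorem finrank_stdZ_eigenspace {ω : S.Dof → ℂ} (hω : ∀ a, ω a ^ S.dofDim a = 1) :
    Module.finrank ℂ (⨅ a, Module.End.eigenspace (Matrix.toLin' (S.stdZ a)) (ω a) :
      Submodule ℂ (S.Basis → ℂ)) = 1 := by
  classical
  have hk : ∀ a, ∃ k < S.dofDim a, S.clock a ^ k = ω a := fun a =>
    (clock_isPrimitiveRoot a).eq_pow_of_pow_eq_one (hω a)
  choose k hk hkω using hk
  obtain ⟨z, hz⟩ := exists_basis_digit hk
  have hmem : ∀ v : S.Basis → ℂ, v ∈ (⨅ a, Module.End.eigenspace (Matrix.toLin' (S.stdZ a)) (ω a) :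
      Submodule ℂ (S.Basis → ℂ)) ↔ ∀ a x, S.clock a ^ S.digit a x * v x = ω a * v x := by
    intro v
    rw [Submodule.mem_iInf]
    refine forall_congr' fun a => ?_
    rw [Module.End.mem_eigenspace_iff, Matrix.toLin'_apply, funext_iff]
    refine forall_congr' fun x => ?_
    rw [stdZ, Matrix.mulVec_diagonal]
    rfl
  have : (⨅ a, Module.End.eigenspace (Matrix.toLin' (S.stdZ a)) (ω a) :
      Submodule ℂ (S.Basis → ℂ)) = Submodule.span ℂ {Pi.single z 1} := by
    ext v
    rw [hmem, Submodule.mem_span_singleton]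
    constructor
    · intro h
      refine ⟨v z, funext fun x => ?_⟩
      by_cases hx : x = z
      · subst hx; simp
      · obtain ⟨a, ha⟩ : ∃ a, S.digit a x ≠ S.digit a z := by
          by_contra h
          push Not at h
          exact hx (basis_ext h)
        have hv : v x = 0 := by
          by_contra hv
          refine ha (clock_pow_digit_injective ?_)
          rw [mul_right_cancel₀ hv (h a x), ← hkω, hz]
        simp [hx, hv]
    · rintro ⟨t, rfl⟩ a x
      by_cases hx : x = z
      · subst hx; rw [hz, hkω]
      · simp [hx]
  rw [this, finrank_span_singleton (by simp)]

variable [MetricSpace Site]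

section Reindex

variable {ι κ : Type*} {R : ℝ} {D : ι → ℕ} {fermionic : ι → Prop} {Z X : ι → S.Op}

theorem IsSeparator.reindex (hZ : S.IsSeparator R D fermionic Z) (e : κ ≃ ι) :
    S.IsSeparator R (D ∘ e) (fermionic ∘ e) (Z ∘ e) where
  unitary _ := hZ.unitary _
  even _ := hZ.even _
  two_le _ := hZ.two_le _
  pow_eq_one _ := hZ.pow_eq_one _
  commute _ _ := hZ.commute _ _
  local_support _ := hZ.local_support _
  one_dimensional ω hω := by
    have := hZ.one_dimensional (fun a => ω (e.symm a)) fun a => by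
      have := hω (e.symm a)
      simpa using this
    rw [← e.iInf_comp] at this
    rwa [iInf_congr fun a => by rw [Equiv.symm_apply_apply]] at this
  fermionic_dim _ := hZ.fermionic_dim _

theorem IsLocalFlipper.reindex (hX : S.IsLocalFlipper R D fermionic Z X) (e : κ ≃ ι) :
    S.IsLocalFlipper R (D ∘ e) (fermionic ∘ e) (Z ∘ e) (X ∘ e) where
  unitary _ := hX.unitary _
  local_support _ := hX.local_support _
  commute _ _ h := hX.commute _ _ (e.injective.ne h)
  flip _ := hX.flip _
  even _ := hX.even _
  odd _ := hX.odd _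

/-- A locally flippable separator together with a local bijection from its elements to the
degrees of freedom is mapped to the trivial separator by a QCA. -/
theorem exists_isQCA_of_equiv {L : ℝ} (hZ : S.IsSeparator R D fermionic Z)
    (hX : S.IsLocalFlipper R D fermionic Z X) {c : ι → Site}
    (hc : ∀ a, S.SupportedOn (Metric.closedBall (c a) R) (X a)) (f : ι ≃ S.Dof)
    (hdim : ∀ a, S.dofDim (f a) = D a) (hferm : ∀ a, fermionic a ↔ (f a).isRight)
    (hloc : ∀ a, dist (S.dofSite (f a)) (c a) ≤ L * R) :
    ∃ α : S.Op ≃⋆ₐ[ℂ] S.Op, S.IsQCA ((6 + L) * R) α ∧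
      S.IsTrivialSeparator D fermionic (fun a => α (Z a)) f := by
  have hD : D ∘ f.symm = S.dofDim := funext fun d => by
    rw [Function.comp_apply, ← hdim, Equiv.apply_symm_apply]
  have hF : fermionic ∘ f.symm = fun d => (d.isRight : Prop) := funext fun d => propext (by
    rw [Function.comp_apply, hferm, Equiv.apply_symm_apply])
  have hZ' := hZ.reindex f.symm
  have hX' := hX.reindex f.symm
  rw [hD, hF] at hZ' hX'
  obtain ⟨α, heven, hodd, hαZ, hα⟩ := exists_automorphism hZ' hX' (c := c ∘ f.symm)
    fun d => hc _
  have hαZ' : ∀ a, α (Z a) = S.stdZ (f a) := fun a => by simpa using hαZ (f a)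
  refine ⟨α, ⟨heven, hodd, fun i O hO => ?_⟩, ⟨?_, fun a ha => ?_, fun a ha => ?_⟩⟩
  -- `6 * R` bounds the distance from the site to the flipper centers, and `L * R` that from the
  -- centers to the matched degrees of freedom.
  · have hsub : {d | dist ((c ∘ f.symm) d) i ≤ 6 * R} ⊆
        S.dofSite ⁻¹' Metric.closedBall i ((6 + L) * R) := ?_
    · exact dofAlgebra_mono hsub (hα i O hO)
    intro d hd
    have h1 := hloc (f.symm d)
    rw [Equiv.apply_symm_apply] at h1
    have h2 : dist (c (f.symm d)) i ≤ 6 * R := hd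
    exact Metric.mem_closedBall.2 (by linarith [dist_triangle (S.dofSite d) (c (f.symm d)) i])
  · refine ⟨fun a => ?_, fun a => heven _ (hZ.even a), hZ.two_le, fun a => ?_, fun a b => ?_,
      fun a => ?_, fun ω hω => ?_, hZ.fermionic_dim⟩
    · have := Unitary.mem_iff.1 (hZ.unitary a)
      rw [Unitary.mem_iff, ← map_star, ← map_mul, ← map_mul, this.1, this.2, map_one]
      exact ⟨rfl, rfl⟩
    · rw [← map_pow, hZ.pow_eq_one, map_one]
    · rw [← map_mul, hZ.commute, map_mul]
    · refine ⟨{S.dofSite (f a)}, ?_, ?_⟩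
      · rintro s rfl t rfl
        rw [dist_self]
      · rw [hαZ']
        have h : f a ∈ S.dofSite ⁻¹' {S.dofSite (f a)} := rfl
        rw [SupportedOn, localAlgebra_eq]
        exact stdZ_mem h
    · have := finrank_stdZ_eigenspace (S := S) (ω := ω ∘ f.symm) fun d => by
        rw [Function.comp_apply, ← hω (f.symm d), ← hdim, Equiv.apply_symm_apply]
      rw [← f.iInf_comp] at this
      rw [iInf_congr fun a => by rw [Function.comp_apply, Equiv.symm_apply_apply]] at this
      rwa [iInf_congr fun a => by rw [hαZ']]
  · rw [hferm] at ha
    obtain ⟨q, hq⟩ : ∃ q, f a = Sum.inl q := by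
      rcases h : f a with q | j
      · exact ⟨q, rfl⟩
      · simp [h] at ha
    exact ⟨q, hq, by rw [hαZ', hq, stdZ_inl]⟩
  · rw [hferm] at ha
    obtain ⟨j, hj⟩ := Sum.isRight_iff.1 ha
    exact ⟨j, hj, by rw [hαZ', hj, stdZ_inr]⟩

end Reindex

end QuantumSystem

/-! ### Joint eigenbases and projections of commuting matrices of finite order. -/

section JointEigenbasis

variable {n : Type*} [Fintype n] [DecidableEq n] {ι : Type*} {D : ι → ℕ} {Z : ι → Matrix n n ℂ}

theorem commute_toLin' {A B : Matrix n n ℂ} (h : A * B = B * A) :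
    Commute (Matrix.toLin' A) (Matrix.toLin' B) := by
  change Matrix.toLin' A ∘ₗ Matrix.toLin' B = Matrix.toLin' B ∘ₗ Matrix.toLin' A
  rw [← Matrix.toLin'_mul, ← Matrix.toLin'_mul, h]

/-- Over the complex numbers `X ^ d - 1` is separable, so a matrix annihilated by it is semisimple.
-/
theorem maxGenEigenspace_eq_eigenspace_of_pow_eq_one {A : Matrix n n ℂ} {d : ℕ} (hd : d ≠ 0)
    (h : A ^ d = 1) (μ : ℂ) :
    Module.End.maxGenEigenspace (Matrix.toLin' A) μ =
      Module.End.eigenspace (Matrix.toLin' A) μ := by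
  refine Module.End.IsFinitelySemisimple.maxGenEigenspace_eq_eigenspace ?_ μ
  refine Module.End.IsSemisimple.isFinitelySemisimple ?_
  refine Module.End.isSemisimple_of_squarefree_aeval_eq_zero (p := Polynomial.X ^ d - 1)
    (Polynomial.Separable.squarefree
      (Polynomial.X_pow_sub_one_separable_iff.2 (Nat.cast_ne_zero.2 hd))) ?_
  rw [map_sub, map_pow, Polynomial.aeval_X, map_one, ← Matrix.toLin'_pow, h, Matrix.toLin'_one]
  exact sub_self _

theorem eigenvalue_pow_eq_one {A : Matrix n n ℂ} {d : ℕ} (h : A ^ d = 1) {μ : ℂ} {v : n → ℂ}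
    (hv : v ≠ 0) (hA : A.mulVec v = μ • v) : μ ^ d = 1 := by
  have hpow : ∀ k : ℕ, (A ^ k).mulVec v = μ ^ k • v := by
    intro k
    induction k with
    | zero => simp
    | succ k ih => rw [pow_succ', ← Matrix.mulVec_mulVec, ih, Matrix.mulVec_smul, hA, smul_smul,
        pow_succ]
  have := hpow d
  rw [h, Matrix.one_mulVec] at this
  have h' : (μ ^ d - 1) • v = 0 := by rw [sub_smul, one_smul, ← this, sub_self]
  exact sub_eq_zero.1 ((smul_eq_zero.1 h').resolve_right hv)

theorem iSupIndep_iInf_eigenspace (hcomm : ∀ a b, Z a * Z b = Z b * Z a) :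
    iSupIndep fun χ : ι → ℂ => (⨅ a, Module.End.eigenspace (Matrix.toLin' (Z a)) (χ a) :
      Submodule ℂ (n → ℂ)) := by
  have h := Module.End.independent_iInf_maxGenEigenspace_of_forall_mapsTo
    (fun a => Matrix.toLin' (Z a)) fun i j φ =>
      Module.End.mapsTo_maxGenEigenspace_of_comm (commute_toLin' (hcomm j i)) φ
  refine h.mono fun χ => ?_
  exact iInf_mono fun a => Module.End.eigenspace_le_maxGenEigenspace

theorem iSup_iInf_eigenspace_eq_top (hcomm : ∀ a b, Z a * Z b = Z b * Z a)
    (hD : ∀ a, D a ≠ 0) (hpow : ∀ a, Z a ^ D a = 1) :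
    ⨆ χ : ι → ℂ, (⨅ a, Module.End.eigenspace (Matrix.toLin' (Z a)) (χ a) :
      Submodule ℂ (n → ℂ)) = ⊤ := by
  have h := Module.End.iSup_iInf_maxGenEigenspace_eq_top_of_iSup_maxGenEigenspace_eq_top_of_commute
    (fun a => Matrix.toLin' (Z a)) (fun i j _ => commute_toLin' (hcomm i j))
    (fun i => Module.End.iSup_maxGenEigenspace_eq_top _)
  simpa only [maxGenEigenspace_eq_eigenspace_of_pow_eq_one (hD _) (hpow _)] using h

/-- The index set of a commuting family of operators of finite order with one-dimensional joint
eigenspaces is finite. -/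
theorem finite_of_one_dimensional (hcomm : ∀ a b, Z a * Z b = Z b * Z a) (hD : ∀ a, 2 ≤ D a)
    (hone : ∀ ω : ι → ℂ, (∀ a, ω a ^ D a = 1) →
      Module.finrank ℂ (⨅ a, Module.End.eigenspace (Matrix.toLin' (Z a)) (ω a) :
        Submodule ℂ (n → ℂ)) = 1) : Finite ι := by
  classical
  -- Admissible eigenvalue families give independent nonzero subspaces, so there are finitely many.
  -- Elements inject into these families by changing a single eigenvalue from one to a primitive
  -- root.
  have hind := (iSupIndep_iInf_eigenspace hcomm).comp
    (Subtype.val_injective (p := fun ω : ι → ℂ => ∀ a, ω a ^ D a = 1))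
  have hfin : Finite {ω : ι → ℂ // ∀ a, ω a ^ D a = 1} := by
    refine WellFoundedGT.finite_of_iSupIndep hind fun ω h => ?_
    have h1 := hone ω.1 ω.2
    simp only [Function.comp_apply] at h
    rw [h, finrank_bot] at h1
    exact zero_ne_one h1
  have hroot : ∀ a, IsPrimitiveRoot (Complex.exp (2 * Real.pi * Complex.I / (D a : ℂ))) (D a) :=
    fun a => Complex.isPrimitiveRoot_exp _ (by have := hD a; omega)
  refine Finite.of_injective (fun a => (⟨Function.update (fun _ => 1) a
    (Complex.exp (2 * Real.pi * Complex.I / (D a : ℂ))), fun b => ?_⟩ :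
      {ω : ι → ℂ // ∀ a, ω a ^ D a = 1})) fun a b hab => ?_
  · by_cases hb : b = a
    · subst hb
      rw [Function.update_self, (hroot b).pow_eq_one]
    · rw [Function.update_of_ne hb, one_pow]
  · by_contra hne
    have := congrFun (congrArg Subtype.val hab) a
    simp only [Function.update_self, Function.update_of_ne hne] at this
    exact (hroot a).ne_one (by have := hD a; omega) this

/-- A basis of joint eigenvectors. -/
theorem exists_joint_eigenbasis (hcomm : ∀ a b, Z a * Z b = Z b * Z a)
    (hD : ∀ a, 2 ≤ D a) (hpow : ∀ a, Z a ^ D a = 1)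
    (hone : ∀ ω : ι → ℂ, (∀ a, ω a ^ D a = 1) →
      Module.finrank ℂ (⨅ a, Module.End.eigenspace (Matrix.toLin' (Z a)) (ω a) :
        Submodule ℂ (n → ℂ)) = 1) :
    ∃ P : Module.Basis (∀ a, Fin (D a)) ℂ (n → ℂ), ∀ z a, (Z a).mulVec (P z) =
      Complex.exp (2 * Real.pi * Complex.I / (D a : ℂ)) ^ (z a : ℕ) • P z := by
  have hroot : ∀ a, IsPrimitiveRoot (Complex.exp (2 * Real.pi * Complex.I / (D a : ℂ))) (D a) :=
    fun a => Complex.isPrimitiveRoot_exp _ (by have := hD a; omega)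
  set ζ : ι → ℂ := fun a => Complex.exp (2 * Real.pi * Complex.I / (D a : ℂ)) with hζ
  let χ : (∀ a, Fin (D a)) → ι → ℂ := fun z a => ζ a ^ (z a : ℕ)
  have hχ : ∀ z a, χ z a ^ D a = 1 := fun z a => by
    simp only [χ]
    rw [pow_right_comm, (hroot a).pow_eq_one, one_pow]
  have hχinj : Function.Injective χ := fun z w h => funext fun a => Fin.ext
    ((hroot a).pow_inj (z a).2 (w a).2 (congrFun h a))
  have hv : ∀ z, ∃ v : n → ℂ, v ≠ 0 ∧ (⨅ a, Module.End.eigenspace (Matrix.toLin' (Z a)) (χ z a) :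
        Submodule ℂ (n → ℂ)) = Submodule.span ℂ {v} := by
    intro z
    obtain ⟨⟨v, hv⟩, hv0, hvs⟩ := finrank_eq_one_iff'.1 (hone (χ z) (hχ z))
    refine ⟨v, fun h => hv0 (Subtype.ext h), le_antisymm (fun w hw => ?_) ?_⟩
    · obtain ⟨c, hc⟩ := hvs ⟨w, hw⟩
      exact Submodule.mem_span_singleton.2 ⟨c, congrArg Subtype.val hc⟩
    · rw [Submodule.span_singleton_le_iff_mem]
      exact hv
  choose v hv0 hvs using hv
  have hvmem : ∀ z, v z ∈ (⨅ a, Module.End.eigenspace (Matrix.toLin' (Z a)) (χ z a) :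
        Submodule ℂ (n → ℂ)) := fun z => by
    rw [hvs]; exact Submodule.mem_span_singleton_self _
  have hli : LinearIndependent ℂ v := iSupIndep.linearIndependent _
    ((iSupIndep_iInf_eigenspace hcomm).comp hχinj) hvmem hv0
  have hspan : ⊤ ≤ Submodule.span ℂ (Set.range v) := by
    rw [← iSup_iInf_eigenspace_eq_top hcomm (fun a => by have := hD a; omega) hpow]
    refine iSup_le fun ω w hw => ?_
    by_cases hw0 : w = 0
    · rw [hw0]; exact zero_mem _
    have hk : ∀ a, ∃ k < D a, ζ a ^ k = ω a := by
      intro a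
      refine haveI : NeZero (D a) := ⟨by have := hD a; omega⟩
        (hroot a).eq_pow_of_pow_eq_one (eigenvalue_pow_eq_one (hpow a) hw0 ?_)
      have := Module.End.mem_eigenspace_iff.1 ((Submodule.mem_iInf _).1 hw a)
      rwa [Matrix.toLin'_apply] at this
    choose k hk hkω using hk
    have hz : ω = χ fun a => ⟨k a, hk a⟩ := funext fun a => (hkω a).symm
    rw [hz, hvs] at hw
    exact Submodule.span_mono (Set.singleton_subset_iff.2 (Set.mem_range_self _)) hw
  refine ⟨Module.Basis.mk hli hspan, fun z a => ?_⟩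
  rw [Module.Basis.mk_apply]
  have := Module.End.mem_eigenspace_iff.1 ((Submodule.mem_iInf _).1 (hvmem z) a)
  rwa [Matrix.toLin'_apply] at this

/-- The projection on the states with eigenvalue one for all elements of `A`. -/
theorem exists_joint_projection (hD : ∀ a, 2 ≤ D a)
    {P : Module.Basis (∀ a, Fin (D a)) ℂ (n → ℂ)}
    (hP : ∀ z a, (Z a).mulVec (P z) =
      Complex.exp (2 * Real.pi * Complex.I / (D a : ℂ)) ^ (z a : ℕ) • P z)
    (A : Finset ι) {L : Subalgebra ℂ (Matrix n n ℂ)} (hL : ∀ a ∈ A, Z a ∈ L) :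
    ∃ Q ∈ L, ∀ z, Q.mulVec (P z) =
      (if ∀ a ∈ A, (z a : ℕ) = 0 then (1 : ℂ) else 0) • P z := by
  classical
  induction A using Finset.induction_on with
  | empty => exact ⟨1, one_mem _, fun z => by simp⟩
  | insert a A haA ih =>
    obtain ⟨Q, hQL, hQ⟩ := ih fun b hb => hL b (Finset.mem_insert_of_mem hb)
    have hpow : ∀ z (k : ℕ), (Z a ^ k).mulVec (P z) =
        (Complex.exp (2 * Real.pi * Complex.I / (D a : ℂ)) ^ (z a : ℕ)) ^ k • P z := by
      intro z k
      induction k with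
      | zero => simp
      | succ k ih => rw [pow_succ', ← Matrix.mulVec_mulVec, ih, Matrix.mulVec_smul, hP, smul_smul,
          pow_succ]
    -- Averaging the powers of `Z a` projects on its eigenvalue one and stays in `L`.
    refine ⟨Q * ((D a : ℂ)⁻¹ • ∑ k ∈ Finset.range (D a), Z a ^ k), mul_mem hQL
      (Subalgebra.smul_mem _ (sum_mem fun k _ => pow_mem (hL a (Finset.mem_insert_self _ _)) k) _),
      fun z => ?_⟩
    rw [← Matrix.mulVec_mulVec, Matrix.smul_mulVec, Matrix.sum_mulVec]
    simp only [hpow]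
    rw [← Finset.sum_smul, smul_smul, Matrix.mulVec_smul, hQ, smul_smul]
    congr 1
    have hD0 : (D a : ℂ) ≠ 0 := Nat.cast_ne_zero.2 (by have := hD a; omega)
    have hroot := Complex.isPrimitiveRoot_exp (D a) (by have := hD a; omega)
    by_cases hz : (z a : ℕ) = 0
    · simp [hz, hD0]
    · have hw1 : Complex.exp (2 * Real.pi * Complex.I / (D a : ℂ)) ^ (z a : ℕ) ≠ 1 :=
        hroot.pow_ne_one_of_pos_of_lt hz (z a).2
      have hsum : (∑ k ∈ Finset.range (D a),
          (Complex.exp (2 * Real.pi * Complex.I / (D a : ℂ)) ^ (z a : ℕ)) ^ k) = 0 := by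
        have := geom_sum_mul
          (Complex.exp (2 * Real.pi * Complex.I / (D a : ℂ)) ^ (z a : ℕ)) (D a)
        rw [pow_right_comm, hroot.pow_eq_one, one_pow, sub_self] at this
        exact (mul_eq_zero.1 this).resolve_right (sub_ne_zero.2 hw1)
      rw [hsum, mul_zero, zero_mul, if_neg]
      intro h
      exact hz (h a (Finset.mem_insert_self _ _))

theorem trace_eq_of_basis {κ : Type*} [Fintype κ] (P : Module.Basis κ ℂ (n → ℂ))
    {Q : Matrix n n ℂ} {d : κ → ℂ} (h : ∀ z, Q.mulVec (P z) = d z • P z) :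
    Q.trace = ∑ z, d z := by
  classical
  rw [← Matrix.trace_toLin'_eq, LinearMap.trace_eq_matrix_trace ℂ P, Matrix.trace]
  refine Finset.sum_congr rfl fun z _ => ?_
  rw [Matrix.diag_apply, LinearMap.toMatrix_apply, Matrix.toLin'_apply, h]
  simp

theorem exists_trace_eq_natCast {Q : Matrix n n ℂ} (h : Q * Q = Q) : ∃ k : ℕ, Q.trace = k := by
  have hi : IsIdempotentElem (Matrix.toLin' Q) := by
    change Matrix.toLin' Q ∘ₗ Matrix.toLin' Q = _
    rw [← Matrix.toLin'_mul, h]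
  exact ⟨_, by
    rw [← Matrix.trace_toLin'_eq, (LinearMap.IsIdempotentElem.isProj_range _ hi).trace]⟩

end JointEigenbasis

/-! ### Traces of operators acting trivially on some qudits. -/

namespace QuantumSystem

variable {Site : Type*} {S : QuantumSystem Site}

open scoped Kronecker

/-- Basis labels of the fermions and of the qudits in `T`. -/
abbrev InnerBasis (S : QuantumSystem Site) (T : Fin S.numQudits → Prop) : Type :=
  ((q : {q // T q}) → Fin (S.quditDim q)) × (Fin S.numFermions → Bool)

/-- Basis labels of the qudits outside `T`. -/
abbrev OuterBasis (S : QuantumSystem Site) (T : Fin S.numQudits → Prop) : Type :=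
  (q : {q // ¬ T q}) → Fin (S.quditDim q)

/-- Splits off the qudits outside `T`. -/
def basisEquiv (S : QuantumSystem Site) (T : Fin S.numQudits → Prop) [DecidablePred T] :
    S.Basis ≃ S.InnerBasis T × S.OuterBasis T :=
  ((Equiv.piEquivPiSubtypeProd T fun q => Fin (S.quditDim q)).prodCongr (Equiv.refl _)).trans
    { toFun := fun x => ((x.1.1, x.2), x.1.2)
      invFun := fun x => ((x.1.1, x.2), x.1.2)
      left_inv := fun _ => rfl
      right_inv := fun _ => rfl }

/-- The operators acting trivially on the qudits outside `T`. -/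
def blockAlgebra (S : QuantumSystem Site) (T : Fin S.numQudits → Prop) [DecidablePred T] :
    Subalgebra ℂ S.Op where
  carrier := {O | ∃ o : Matrix (S.InnerBasis T) (S.InnerBasis T) ℂ, O = (o ⊗ₖ (1 : Matrix (S.OuterBasis T) (S.OuterBasis T) ℂ)).submatrix
        (S.basisEquiv T) (S.basisEquiv T)}
  mul_mem' := by
    rintro _ _ ⟨o, rfl⟩ ⟨o', rfl⟩
    refine ⟨o * o', ?_⟩
    rw [Matrix.submatrix_mul_equiv, ← Matrix.mul_kronecker_mul, mul_one]
  add_mem' := by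
    rintro _ _ ⟨o, rfl⟩ ⟨o', rfl⟩
    refine ⟨o + o', ?_⟩
    rw [Matrix.add_kronecker]
    rfl
  algebraMap_mem' r := by
    refine ⟨r • 1, ?_⟩
    rw [Matrix.smul_kronecker, Matrix.one_kronecker_one, Algebra.algebraMap_eq_smul_one]
    change _ = r • Matrix.submatrix 1 (S.basisEquiv T) (S.basisEquiv T)
    rw [Matrix.submatrix_one_equiv]

theorem mem_blockAlgebra {T : Fin S.numQudits → Prop} [DecidablePred T] {O : S.Op}
    (h : ∃ o : Matrix (S.InnerBasis T) (S.InnerBasis T) ℂ,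
      ∀ x y : S.Basis, O x y = if ∀ q, ¬ T q → x.1 q = y.1 q then
        o (fun q => x.1 q.1, x.2) (fun q => y.1 q.1, y.2) else 0) : O ∈ S.blockAlgebra T := by
  obtain ⟨o, ho⟩ := h
  refine ⟨o, ?_⟩
  ext x y
  rw [ho, Matrix.submatrix_apply, Matrix.kronecker_apply, Matrix.one_apply, mul_ite, mul_one,
    mul_zero]
  refine if_congr ?_ rfl rfl
  change _ ↔ (fun q : {q // ¬ T q} => x.1 q.1) = fun q : {q // ¬ T q} => y.1 q.1
  rw [funext_iff, Subtype.forall]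

/-- Majorana strings run through other fermions but never through qudits. For this reason all
fermionic modes stay in the inner factor, wherever they are located. -/
theorem dofAlgebra_le_blockAlgebra {N : Set S.Dof} {T : Fin S.numQudits → Prop} [DecidablePred T]
    (h : ∀ q, Sum.inl q ∈ N → T q) : S.dofAlgebra N ≤ S.blockAlgebra T := by
  have hsplit : ∀ x y : S.Basis, x.1 = y.1 ↔ (∀ q, ¬ T q → x.1 q = y.1 q) ∧
      (fun q : {q // T q} => x.1 q.1) = fun q : {q // T q} => y.1 q.1 := by
    intro x y
    rw [funext_iff, funext_iff, Subtype.forall]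
    refine ⟨fun h => ⟨fun q _ => h q, fun q _ => h q⟩, fun h q => ?_⟩
    by_cases hq : T q
    · exact h.2 q hq
    · exact h.1 q hq
  refine Algebra.adjoin_le ?_
  rintro O (⟨j, hj, rfl | rfl⟩ | ⟨q, A, hq, rfl⟩)
  · refine mem_blockAlgebra ⟨Matrix.of fun x y : S.InnerBasis T =>
      if x.1 = y.1 ∧ x.2 = Function.update y.2 j (!y.2 j) then S.stringSign j y.2 else 0,
      fun x y => ?_⟩
    simp only [majorana, Matrix.of_apply, hsplit, ← ite_and, and_assoc]
  · refine mem_blockAlgebra ⟨Matrix.of fun x y : S.InnerBasis T =>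
      if x.1 = y.1 ∧ x.2 = Function.update y.2 j (!y.2 j) then
        S.stringSign j y.2 * (if y.2 j then -Complex.I else Complex.I) else 0,
      fun x y => ?_⟩
    simp only [majorana', Matrix.of_apply, hsplit, ← ite_and, and_assoc]
  · have hTq := h q hq
    refine mem_blockAlgebra ⟨Matrix.of fun x y : S.InnerBasis T =>
      if x.2 = y.2 ∧ ∀ r : {r // T r}, r.1 ≠ q → x.1 r = y.1 r then
        A (x.1 ⟨q, hTq⟩) (y.1 ⟨q, hTq⟩) else 0, fun x y => ?_⟩
    simp only [quditOp, Matrix.of_apply, ← ite_and]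
    refine if_congr ⟨fun h => ⟨fun r hr => h.2 r ?_, h.1, fun r hr => h.2 r.1 hr⟩, fun h =>
      ⟨h.2.1, fun r hr => ?_⟩⟩ rfl rfl
    · rintro rfl; exact hr hTq
    · by_cases hTr : T r
      · exact h.2.2 ⟨r, hTr⟩ hr
      · exact h.1 r hTr

/-- The trace of an idempotent acting trivially on the qudits outside `T` is a multiple of the
dimension of these qudits. -/
theorem exists_trace_eq_of_mem_blockAlgebra {T : Fin S.numQudits → Prop} [DecidablePred T]
    {Q : S.Op} (hQ : Q ∈ S.blockAlgebra T) (hQQ : Q * Q = Q) :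
    ∃ k : ℕ, Q.trace = ((k * ∏ q : {q // ¬ T q}, S.quditDim q : ℕ) : ℂ) := by
  obtain ⟨o, rfl⟩ := hQ
  have hoo : o * o = o := by
    rw [Matrix.submatrix_mul_equiv, ← Matrix.mul_kronecker_mul, mul_one] at hQQ
    ext x y
    have := congrFun (congrFun hQQ ((S.basisEquiv T).symm (x, fun _ => 0)))
      ((S.basisEquiv T).symm (y, fun _ => 0))
    simpa [Matrix.kronecker_apply] using this
  obtain ⟨k, hk⟩ := exists_trace_eq_natCast hoo
  refine ⟨k, ?_⟩
  have : ((o ⊗ₖ (1 : Matrix (S.OuterBasis T) (S.OuterBasis T) ℂ)).submatrix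
        (S.basisEquiv T) (S.basisEquiv T)).trace =
      (o ⊗ₖ (1 : Matrix (S.OuterBasis T) (S.OuterBasis T) ℂ)).trace :=
    (S.basisEquiv T).sum_comp fun x => (o ⊗ₖ (1 : Matrix (S.OuterBasis T) (S.OuterBasis T) ℂ)) x x
  rw [this, Matrix.trace_kronecker, hk, Matrix.trace_one, Nat.cast_mul]
  congr 2
  simp [Fintype.card_pi]

end QuantumSystem

/-- A target missed by `f` would contribute an extra factor of at least two to the product. -/
theorem bijective_of_prod_eq {ι κ : Type*} [Fintype ι] [Fintype κ] {D : ι → ℕ} {D' : κ → ℕ}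
    (hD : ∀ a, 0 < D a) (hD' : ∀ d, 2 ≤ D' d) (h : ∏ a, D a = ∏ d, D' d) {f : ι → κ}
    (hf : Function.Injective f) (hfD : ∀ a, D' (f a) = D a) : Function.Bijective f := by
  classical
  refine ⟨hf, fun d => ?_⟩
  by_contra hd
  have h1 : ∏ d ∈ Finset.univ.image f, D' d = ∏ a, D a := by
    rw [Finset.prod_image fun a _ b _ hab => hf hab]
    exact Finset.prod_congr rfl fun a _ => hfD a
  have h2 := Finset.prod_mul_prod_compl (Finset.univ.image f) D'
  rw [h1, ← h] at h2
  have h3 : ∏ d ∈ (Finset.univ.image f)ᶜ, D' d = 1 :=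
    Nat.eq_of_mul_eq_mul_left (Finset.prod_pos fun a _ => hD a) (by rw [h2, mul_one])
  have h4 := Finset.prod_eq_one_iff.1 h3 d (by
    simp only [Finset.mem_compl, Finset.mem_image, Finset.mem_univ, true_and]
    exact hd)
  have := hD' d
  omega

theorem card_le_of_pow_dvd_prod {κ : Type*} (s : Finset κ) {D : κ → ℕ} (hD : ∀ q, (D q).Prime)
    {p n : ℕ} (hp : p.Prime) (h : p ^ n ∣ ∏ q ∈ s, D q) : n ≤ (s.filter (D · = p)).card := by
  rw [← Finset.prod_filter_mul_prod_filter_not s (D · = p),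
    Finset.prod_congr rfl fun q hq => (Finset.mem_filter.1 hq).2, Finset.prod_const] at h
  have hcop : Nat.Coprime (p ^ n) (∏ q ∈ s.filter (¬ D · = p), D q) := by
    refine Nat.Coprime.prod_right fun q hq => Nat.Coprime.pow_left _ ?_
    exact (Nat.coprime_primes hp (hD q)).2 (Ne.symm (Finset.mem_filter.1 hq).2)
  exact (Nat.pow_dvd_pow_iff_le_right hp.one_lt).1 (hcop.dvd_of_dvd_mul_right h)

/-! ### Dimension counting and Hall's theorem. -/

namespace QuantumSystem

variable {Site : Type*} {S : QuantumSystem Site}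

theorem card_basis : Fintype.card S.Basis = (∏ q, S.quditDim q) * 2 ^ S.numFermions := by
  simp [Fintype.card_prod, Fintype.card_pi]

theorem prod_dofDim : ∏ d, S.dofDim d = (∏ q, S.quditDim q) * 2 ^ S.numFermions := by
  rw [Fintype.prod_sum_type]
  simp [dofDim]

/-- Without fermions the parity operator is the identity, so an odd operator is its own negative.
This excludes fermionic elements. -/
theorem not_isOdd_of_numFermions_eq_zero (h : S.numFermions = 0) {O : S.Op}
    (hO : O ∈ unitary S.Op) : ¬ S.IsOdd O := by
  intro ho
  have : IsEmpty (Fin S.numFermions) := by rw [h]; infer_instance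
  have hp : S.parityOp = 1 := by
    rw [parityOp_eq, ← Matrix.diagonal_one]
    congr 1
    funext y
    simp [parityPhase]
  have ho' : S.parityOp * O = -(O * S.parityOp) := ho
  rw [hp, one_mul, mul_one] at ho'
  have h0 : O = 0 := by
    ext x y
    exact self_eq_neg.1 (congrFun (congrFun ho' x) y)
  rw [h0, Unitary.mem_iff] at hO
  simp at hO

variable [MetricSpace Site] {ι : Type*} {R : ℝ} {D : ι → ℕ} {fermionic : ι → Prop}
  {Z X : ι → S.Op}

theorem IsSeparator.finite (hZ : S.IsSeparator R D fermionic Z) : Finite ι :=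
  finite_of_one_dimensional hZ.commute hZ.two_le hZ.one_dimensional

theorem IsSeparator.prod_eq [Fintype ι] (hZ : S.IsSeparator R D fermionic Z) :
    ∏ a, D a = (∏ q, S.quditDim q) * 2 ^ S.numFermions := by
  classical
  obtain ⟨P, -⟩ := exists_joint_eigenbasis hZ.commute hZ.two_le hZ.pow_eq_one hZ.one_dimensional
  have := Module.finrank_eq_card_basis P
  rw [Module.finrank_fintype_fun_eq_card, card_basis, Fintype.card_pi] at this
  simpa using this.symm

/-- The elements of dimension `p` in a region need enough dimension of the degrees of freedom
in that region. -/
theorem IsSeparator.pow_card_dvd [Fintype ι] (hZ : S.IsSeparator R D fermionic Z) {p : ℕ}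
    {A : Finset ι} (hA : ∀ a ∈ A, D a = p) {N : Set S.Dof} (hN : ∀ a ∈ A, Z a ∈ S.dofAlgebra N)
    {T : Fin S.numQudits → Prop} [DecidablePred T] (hT : ∀ q, Sum.inl q ∈ N → T q) :
    p ^ A.card ∣ 2 ^ S.numFermions * ∏ q ∈ Finset.univ.filter T, S.quditDim q := by
  classical
  obtain ⟨P, hP⟩ := exists_joint_eigenbasis hZ.commute hZ.two_le hZ.pow_eq_one hZ.one_dimensional
  obtain ⟨Q, hQ, hQP⟩ := exists_joint_projection hZ.two_le hP A hN
  have hQQ : Q * Q = Q := by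
    refine Matrix.toLin'.injective (P.ext fun z => ?_)
    rw [Matrix.toLin'_apply, Matrix.toLin'_apply, ← Matrix.mulVec_mulVec, hQP, Matrix.mulVec_smul,
      hQP, smul_smul]
    split_ifs <;> simp
  -- The trace of `Q` is `k` times the dimension of the qudits outside `T`, and also the product of
  -- `D` over the complement of `A`. Comparison with the total dimension cancels the outer qudits.
  obtain ⟨k, hk⟩ := exists_trace_eq_of_mem_blockAlgebra (dofAlgebra_le_blockAlgebra hT hQ) hQQ
  have htr : Q.trace =
      ((Finset.univ.filter fun z : ∀ a, Fin (D a) => ∀ a ∈ A, (z a : ℕ) = 0).card : ℂ) := by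
    rw [trace_eq_of_basis P hQP, Finset.natCast_card_filter]
    congr!
  rw [htr, Nat.cast_inj] at hk
  have hD0 : ∀ a, NeZero (D a) := fun a => ⟨by have := hZ.two_le a; omega⟩
  have hcard : (Finset.univ.filter fun z : ∀ a, Fin (D a) => ∀ a ∈ A, (z a : ℕ) = 0).card =
      ∏ a, if a ∈ A then 1 else D a := by
    have : (Finset.univ.filter fun z : ∀ a, Fin (D a) => ∀ a ∈ A, (z a : ℕ) = 0) =
        Fintype.piFinset fun a => if a ∈ A then {0} else Finset.univ := by
      ext z
      simp only [Finset.mem_filter, Finset.mem_univ, true_and, Fintype.mem_piFinset]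
      refine forall_congr' fun a => ?_
      by_cases ha : a ∈ A
      · rw [if_pos ha, Finset.mem_singleton]
        exact ⟨fun h => Fin.ext (h ha), fun h _ => by rw [h]; rfl⟩
      · simp [ha]
    rw [this, Fintype.card_piFinset]
    refine Finset.prod_congr rfl fun a _ => ?_
    split_ifs <;> simp
  have hprod : p ^ A.card * ∏ a, (if a ∈ A then 1 else D a) = ∏ a, D a := by
    have : p ^ A.card = ∏ a, if a ∈ A then D a else 1 := by
      rw [Finset.prod_ite_mem, Finset.univ_inter, Finset.prod_congr rfl hA, Finset.prod_const]
    rw [this, ← Finset.prod_mul_distrib]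
    exact Finset.prod_congr rfl fun a _ => by split_ifs <;> simp
  have hsplit : (∏ q ∈ Finset.univ.filter T, S.quditDim q) *
      ∏ q : {q // ¬ T q}, S.quditDim q = ∏ q, S.quditDim q := by
    rw [← Finset.prod_filter_mul_prod_filter_not Finset.univ T]
    congr 1
    exact (Finset.prod_subtype _ (by simp) _).symm
  rw [← hcard, hk, hZ.prod_eq, ← hsplit] at hprod
  have hpos : 0 < ∏ q : {q // ¬ T q}, S.quditDim q :=
    Finset.prod_pos fun q _ => (S.quditDim_prime q).pos
  refine ⟨k, Nat.eq_of_mul_eq_mul_right hpos ?_⟩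
  linarith

/-- The elements of dimension `p` can be matched with nearby qudits. -/
theorem IsLocalFlipper.exists_matching (hZ : S.IsSeparator R D fermionic Z)
    (hX : S.IsLocalFlipper R D fermionic Z X) {c : ι → Site}
    (hc : ∀ a, S.SupportedOn (Metric.closedBall (c a) R) (X a)) {p : ℕ} (hp : p.Prime)
    (hp2 : p ≠ 2 ∨ S.numFermions = 0) :
    ∃ f : {a // D a = p} → Fin S.numQudits, Function.Injective f ∧
      ∀ a, S.quditDim (f a) = p ∧ dist (S.quditSite (f a)) (c a) ≤ 2 * R := by
  classical
  have := hZ.finite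
  let _ := Fintype.ofFinite ι
  have hall := (Finset.all_card_le_biUnion_card_iff_exists_injective
    fun a : {a // D a = p} => Finset.univ.filter fun q : Fin S.numQudits =>
      S.quditDim q = p ∧ dist (S.quditSite q) (c a) ≤ 2 * R).1
  suffices h : _ by
    obtain ⟨f, hf, hft⟩ := hall h
    exact ⟨f, hf, fun a => (Finset.mem_filter.1 (hft a)).2⟩
  · intro s
    have hdvd := hZ.pow_card_dvd (p := p) (A := s.map (Function.Embedding.subtype _))
      (N := S.dofSite ⁻¹' ⋃ a ∈ s, Metric.closedBall (c a) (2 * R))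
      (T := fun q => ∃ a ∈ s, dist (S.quditSite q) (c a) ≤ 2 * R)
      (fun a ha => by
        obtain ⟨b, -, rfl⟩ := Finset.mem_map.1 ha
        exact b.2)
      (fun a ha => by
        obtain ⟨b, hb, rfl⟩ := Finset.mem_map.1 ha
        refine dofAlgebra_mono (Set.preimage_mono ?_) (hX.separator_mem hZ (hc b))
        exact Set.subset_biUnion_of_mem (u := fun a : {a // D a = p} =>
          Metric.closedBall (c a) (2 * R)) hb)
      (fun q hq => by
        obtain ⟨a, ha, hqa⟩ := Set.mem_iUnion₂.1 hq
        exact ⟨a, ha, Metric.mem_closedBall.1 hqa⟩)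
    -- The fermionic factor is not localized, so it must be coprime to `p` to be discarded.
    have hcop : Nat.Coprime (p ^ (s.map (Function.Embedding.subtype _)).card)
        (2 ^ S.numFermions) := by
      rcases hp2 with h | h
      · exact Nat.Coprime.pow _ _ ((Nat.coprime_primes hp Nat.prime_two).2 h)
      · rw [h, pow_zero]; exact Nat.coprime_one_right _
    have hle := card_le_of_pow_dvd_prod _ S.quditDim_prime hp (hcop.dvd_of_dvd_mul_left hdvd)
    rw [Finset.card_map] at hle
    refine hle.trans (Finset.card_le_card fun q hq => ?_)
    obtain ⟨hq1, hq2⟩ := Finset.mem_filter.1 hq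
    obtain ⟨a, ha, hqa⟩ := (Finset.mem_filter.1 hq1).2
    exact Finset.mem_biUnion.2 ⟨a, ha, Finset.mem_filter.2 ⟨Finset.mem_univ _, hq2, hqa⟩⟩

/-- Matchings of the elements of every dimension combine to a bijection. -/
theorem IsSeparator.exists_equiv (hZ : S.IsSeparator R D fermionic Z)
    {F : ∀ p, {a // D a = p} → S.Dof} (hF : ∀ a, Function.Injective (F (D a)))
    (hdim : ∀ a, S.dofDim (F (D a) ⟨a, rfl⟩) = D a) :
    ∃ f : ι ≃ S.Dof, ∀ p a, f (a : {a // D a = p}) = F p a := by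
  have := hZ.finite
  let _ := Fintype.ofFinite ι
  -- Elements of different dimension have images of different dimension, so injectivity within each
  -- dimension suffices.
  have hinj : Function.Injective fun a => F (D a) ⟨a, rfl⟩ := by
    intro a b hab
    have hD : D b = D a := by
      rw [← hdim a, ← hdim b]
      exact congrArg _ hab.symm
    have key : ∀ p (hb : D b = p), F (D b) ⟨b, rfl⟩ = F p ⟨b, hb⟩ := by
      rintro p rfl; rfl
    have h : F (D a) ⟨a, rfl⟩ = F (D a) ⟨b, hD⟩ := by
      rw [← key _ hD]; exact hab
    exact congrArg Subtype.val (hF a h)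
  refine ⟨Equiv.ofBijective _ (bijective_of_prod_eq (fun a => ?_) S.two_le_dofDim ?_ hinj hdim), ?_⟩
  · have := hZ.two_le a; omega
  · rw [hZ.prod_eq, prod_dofDim]
  · rintro p ⟨a, rfl⟩
    rfl

end QuantumSystem

/-! ### Combining the local matchings with the automorphism. -/

namespace QuantumSystem

variable {Site : Type*} [MetricSpace Site] {S : QuantumSystem Site} {ι : Type*} {R L : ℝ}
  {D : ι → ℕ} {fermionic : ι → Prop} {Z X : ι → S.Op}

/-- Local matchings of the elements of every dimension lead to a QCA which trivializes the
separator. -/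
theorem exists_isQCA_of_matching (hZ : S.IsSeparator R D fermionic Z)
    (hX : S.IsLocalFlipper R D fermionic Z X) {c : ι → Site}
    (hc : ∀ a, S.SupportedOn (Metric.closedBall (c a) R) (X a)) {F : ∀ p, {a // D a = p} → S.Dof}
    (hF : ∀ a, Function.Injective (F (D a)))
    (hFa : ∀ p a, S.dofDim (F p a) = p ∧ (fermionic a ↔ (F p a).isRight) ∧
      dist (S.dofSite (F p a)) (c a) ≤ L * R) :
    ∃ (α : S.Op ≃⋆ₐ[ℂ] S.Op) (f : ι ≃ S.Dof), S.IsQCA ((6 + L) * R) α ∧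
      S.IsTrivialSeparator D fermionic (fun a => α (Z a)) f ∧
      ∀ p a, f (a : {a // D a = p}) = F p a := by
  obtain ⟨f, hf⟩ := hZ.exists_equiv hF fun a => (hFa _ ⟨a, rfl⟩).1
  have hfa : ∀ a, f a = F (D a) ⟨a, rfl⟩ := fun a => hf (D a) ⟨a, rfl⟩
  obtain ⟨α, hα, ht⟩ := exists_isQCA_of_equiv (L := L) hZ hX hc f
    (fun a => by rw [hfa]; exact (hFa _ ⟨a, rfl⟩).1)
    (fun a => by rw [hfa]; exact (hFa _ ⟨a, rfl⟩).2.1)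
    fun a => by rw [hfa]; exact (hFa _ ⟨a, rfl⟩).2.2
  exact ⟨α, f, hα, ht, hf⟩

/-- Hall's theorem matches within `2 * R` for every prime, including two, so the range is `(6 + 2) *
R`. -/
theorem exists_isQCA_of_numFermions_eq_zero (h0 : S.numFermions = 0) (hD : ∀ a, (D a).Prime)
    (hZ : S.IsSeparator R D fermionic Z) (hX : S.IsLocalFlipper R D fermionic Z X) :
    ∃ (α : S.Op ≃⋆ₐ[ℂ] S.Op) (f : ι ≃ S.Dof), S.IsQCA (8 * R) α ∧
      S.IsTrivialSeparator D fermionic (fun a => α (Z a)) f ∧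
      ∀ a, ∃ q, f a = Sum.inl q ∧ α (Z a) = S.pauliZ q := by
  choose c hc using hX.local_support
  have hferm : ∀ a, ¬ fermionic a := fun a ha =>
    not_isOdd_of_numFermions_eq_zero h0 (hX.unitary a) (hX.odd a ha)
  have hmatch : ∀ p, ∃ F : {a // D a = p} → S.Dof, Function.Injective F ∧ ∀ a,
      S.dofDim (F a) = p ∧ (fermionic a ↔ (F a).isRight) ∧
      dist (S.dofSite (F a)) (c a) ≤ 2 * R := by
    intro p
    by_cases hp : p.Prime
    · obtain ⟨f, hf, hfa⟩ := hX.exists_matching hZ hc hp (Or.inr h0)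
      refine ⟨fun a => Sum.inl (f a), Sum.inl_injective.comp hf, fun a => ⟨(hfa a).1, ?_,
        (hfa a).2⟩⟩
      simp [hferm]
    · have : IsEmpty {a // D a = p} := ⟨fun a => hp (a.2 ▸ hD a)⟩
      exact ⟨isEmptyElim, Function.injective_of_subsingleton _, isEmptyElim⟩
  choose F hF hFa using hmatch
  obtain ⟨α, f, hα, ht, -⟩ := exists_isQCA_of_matching hZ hX hc (fun a => hF (D a)) hFa
  refine ⟨α, f, ?_, ht, fun a => ht.qudit a (hferm a)⟩
  convert hα using 2
  norm_num

/-- For dimension two `g` replaces Hall's matching: its site is within `K * R` of a point of the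
supporting disk, which lies within `2 * R` of the flipper center. The other primes need `2 * R`;
since `K` may be negative, the maximum is taken. -/
theorem exists_isQCA_of_matching_two {K : ℝ} (hD : ∀ a, (D a).Prime)
    (hZ : S.IsSeparator R D fermionic Z) (hX : S.IsLocalFlipper R D fermionic Z X)
    (g : {a // D a = 2} ≃ {d : S.Dof // S.dofDim d = 2})
    (hg : ∀ a : {a // D a = 2}, ∃ Ω, S.IsSupportingDisk R (Z a) Ω ∧
      ∃ s ∈ Ω, dist s (S.dofSite (g a)) ≤ K * R)
    (hge : ∀ a : {a // D a = 2}, S.IsEven (X a) → ∃ q, (g a : S.Dof) = Sum.inl q)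
    (hgo : ∀ a : {a // D a = 2}, S.IsOdd (X a) → ∃ j, (g a : S.Dof) = Sum.inr j) :
    ∃ (α : S.Op ≃⋆ₐ[ℂ] S.Op) (f : ι ≃ S.Dof), S.IsQCA ((6 + max 2 (2 + K)) * R) α ∧
      S.IsTrivialSeparator D fermionic (fun a => α (Z a)) f ∧
      ∀ a : {a // D a = 2}, f a = g a := by
  choose c hc using hX.local_support
  have hmatch : ∀ p, ∃ F : {a // D a = p} → S.Dof, Function.Injective F ∧ (∀ a,
      S.dofDim (F a) = p ∧ (fermionic a ↔ (F a).isRight) ∧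
      dist (S.dofSite (F a)) (c a) ≤ max 2 (2 + K) * R) ∧
      ∀ (h : p = 2) a, F a = g ⟨a.1, a.2.trans h⟩ := by
    intro p
    by_cases hp : p.Prime
    · by_cases hp2 : p = 2
      · subst hp2
        refine ⟨fun a => g a, Subtype.val_injective.comp g.injective, fun a => ⟨(g a).2, ?_, ?_⟩,
          fun _ _ => rfl⟩
        · by_cases ha : fermionic a
          · obtain ⟨j, hj⟩ := hgo a (hX.odd a ha)
            simp [ha, hj]
          · obtain ⟨q, hq⟩ := hge a (hX.even a ha)
            simp [ha, hq]
        · obtain ⟨Ω, hΩ, s, hs, hsg⟩ := hg a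
          have h1 := Metric.mem_closedBall.1 (hX.supportingDisk_subset hZ hΩ (hc a) hs)
          have h2 := mul_le_mul_of_nonneg_right (le_max_right 2 (2 + K))
            (hX.radius_nonneg hZ a.1)
          rw [dist_comm] at hsg
          linarith [dist_triangle (S.dofSite (g a)) s (c a)]
      · obtain ⟨f, hf, hfa⟩ := hX.exists_matching hZ hc hp (Or.inl hp2)
        refine ⟨fun a => Sum.inl (f a), Sum.inl_injective.comp hf, fun a => ⟨(hfa a).1, ?_, ?_⟩,
          fun h => absurd h hp2⟩
        · have : ¬ fermionic a := fun ha => hp2 (a.2.symm.trans (hZ.fermionic_dim a ha))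
          simp [this]
        · exact (hfa a).2.trans (mul_le_mul_of_nonneg_right (le_max_left _ _)
            (hX.radius_nonneg hZ a.1))
    · have : IsEmpty {a // D a = p} := ⟨fun a => hp (a.2 ▸ hD a)⟩
      exact ⟨isEmptyElim, Function.injective_of_subsingleton _, isEmptyElim, fun _ => isEmptyElim⟩
  choose F hF hFa hFg using hmatch
  obtain ⟨α, f, hα, ht, hf⟩ := exists_isQCA_of_matching hZ hX hc (fun a => hF (D a)) hFa
  exact ⟨α, f, hα, ht, fun a => (hf 2 a).trans (hFg 2 rfl a)⟩

end QuantumSystem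

theorem mainTheorem5 :
    -- systems without fermionic degrees of freedom
    (∃ C : ℝ, ∀ (Site : Type*) [MetricSpace Site] (S : QuantumSystem Site) (ι : Type*) (R : ℝ)
      (D : ι → ℕ) (fermionic : ι → Prop) (Z : ι → S.Op),
      S.numFermions = 0 →
      (∀ a, (D a).Prime) →
      S.IsSeparator R D fermionic Z →
      S.LocallyFlippable R D fermionic Z →
      ∃ (α : S.Op ≃⋆ₐ[ℂ] S.Op) (f : ι ≃ S.Dof),
        S.IsQCA (C * R) α ∧
        S.IsTrivialSeparator D fermionic (fun a => α (Z a)) f ∧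
        ∀ a, ∃ q, f a = Sum.inl q ∧ α (Z a) = S.pauliZ q) ∧
    -- systems with fermionic degrees of freedom
    (∀ K : ℝ, ∃ C : ℝ, ∀ (Site : Type*) [MetricSpace Site] (S : QuantumSystem Site) (ι : Type*)
      (R : ℝ) (D : ι → ℕ) (fermionic : ι → Prop) (Z X : ι → S.Op)
      (g : {a // D a = 2} ≃ {d : S.Dof // S.dofDim d = 2}),
      (∀ a, (D a).Prime) →
      S.IsSeparator R D fermionic Z →
      S.IsLocalFlipper R D fermionic Z X →
      (∀ a : {a // D a = 2}, ∃ Ω, S.IsSupportingDisk R (Z a) Ω ∧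
        ∃ s ∈ Ω, dist s (S.dofSite (g a)) ≤ K * R) →
      (∀ a : {a // D a = 2}, S.IsEven (X a) → ∃ q, (g a : S.Dof) = Sum.inl q) →
      (∀ a : {a // D a = 2}, S.IsOdd (X a) → ∃ j, (g a : S.Dof) = Sum.inr j) →
      ∃ (α : S.Op ≃⋆ₐ[ℂ] S.Op) (f : ι ≃ S.Dof),
        S.IsQCA (C * R) α ∧
        S.IsTrivialSeparator D fermionic (fun a => α (Z a)) f ∧
        ∀ a : {a // D a = 2}, f a = g a) := by
  refine ⟨⟨8, fun Site _ S ι R D fermionic Z h0 hD hZ ⟨X, hX⟩ =>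
    QuantumSystem.exists_isQCA_of_numFermions_eq_zero h0 hD hZ hX⟩, fun K =>
    ⟨6 + max 2 (2 + K), fun Site _ S ι R D fermionic Z X g hD hZ hX hg hge hgo =>
      QuantumSystem.exists_isQCA_of_matching_two hD hZ hX g hg hge hgo⟩⟩
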